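/- Let $H^3$ be hyperbolic $3$-space (the Poincaré open unit ball), whose sphere at infinity $S^2_\infty$ is identified with the Riemann sphere $\mathbb{C}P^1=\mathbb{C}\cup\{\infty\}$ by stereographic projection. Let $x_1,x_2,x_3,x_4$ be four distinct points of $H^3$. For $i\neq j$ let $t_{ij}\in\mathbb{C}\cup\{\infty\}$ be the limit point at infinity of the hyperbolic ray based at $x_i$ and passing through $x_j$. For each $i$ let $p_i$ be a polynomial in one variable $t$, of formal degree $3$, with roots $t_{ij}$, $j\neq i$, counted with multiplicity; that is, $p_i$ is a nonzero scalar multiple of the product of the factors $t-t_{ij}$ over those $j\ne i$ with $t_{ij}\neq\infty$ (each root at $\infty$ lowers the degree by one). Theorem. (1) If $x_1,\dots,x_4$ do not lie in a common hyperbolic plane, then $p_1,p_2,p_3,p_4$ are linearly independent over $\mathbb{C}$. (2) If $x_1,\dots,x_4$ lie in a common hyperbolic plane and one of the points lies in the hyperbolic convex hull of the other three, then $p_1,p_2,p_3,p_4$ are linearly independent over $\mathbb{C}$. -/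

import Mathlib

open Polynomial

namespace AtiyahHyperbolic

/-- Euclidean three-space. -/
abbrev E3 : Type := EuclideanSpace ℝ (Fin 3)

/-- Hyperbolic three-space `H³` in the Poincaré model: the open unit ball. -/
def H3 : Type := {x : E3 // ‖x‖ < 1}

/-- The point of the unit ball that represents a point of `H³`. -/
def H3.pos (x : H3) : E3 := x.1

theorem H3.norm_pos_lt (x : H3) : ‖x.pos‖ < 1 := x.2

/-- The hyperbolic distance (curvature `-1`) of the Poincaré ball:
`sinh (d / 2) = ‖x - y‖ / √((1 - ‖x‖²) (1 - ‖y‖²))`. -/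
noncomputable def hdist (x y : H3) : ℝ :=
  2 * Real.arsinh (‖x.pos - y.pos‖ / √((1 - ‖x.pos‖ ^ 2) * (1 - ‖y.pos‖ ^ 2)))

/-- `y` lies on the geodesic segment with end points `x` and `z`. -/
def HBetween (x y z : H3) : Prop := hdist x y + hdist y z = hdist x z

/-- The geodesic ray based at `x` and passing through `y` (for `x ≠ y`). -/
def hray (x y : H3) : Set H3 := {z | HBetween x z y ∨ HBetween x y z}

/-- `ξ` is a limit point at infinity of the ray based at `x` and passing through `y`: it lies on
the unit sphere and in the Euclidean closure of the ray. -/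
def IsRayLimit (x y : H3) (ξ : E3) : Prop :=
  ‖ξ‖ = 1 ∧ ξ ∈ closure (H3.pos '' hray x y)

/-- The sphere at infinity of `H³`. -/
abbrev SphereAtInfinity : Type := Metric.sphere (0 : E3) 1

theorem one_sub_normSq_pos (x : H3) : 0 < 1 - ‖x.pos‖ ^ 2 := by
  have h1 := x.norm_pos_lt
  have h0 := norm_nonneg x.pos
  nlinarith

theorem hdist_nonneg (x y : H3) : 0 ≤ hdist x y := by
  unfold hdist
  have : 0 ≤ Real.arsinh (‖x.pos - y.pos‖ / √((1 - ‖x.pos‖ ^ 2) * (1 - ‖y.pos‖ ^ 2))) :=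
    Real.arsinh_nonneg_iff.2 (by positivity)
  linarith

theorem cosh_hdist (x y : H3) : Real.cosh (hdist x y) =
    1 + 2 * ‖x.pos - y.pos‖ ^ 2 / ((1 - ‖x.pos‖ ^ 2) * (1 - ‖y.pos‖ ^ 2)) := by
  have hx := one_sub_normSq_pos x
  have hy := one_sub_normSq_pos y
  unfold hdist
  rw [Real.cosh_two_mul, Real.cosh_sq, Real.sinh_arsinh, div_pow, Real.sq_sqrt (by positivity)]
  ring

theorem hdist_pos {x y : H3} (h : x ≠ y) : 0 < hdist x y := by
  have hx := one_sub_normSq_pos x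
  have hy := one_sub_normSq_pos y
  have hn : 0 < ‖x.pos - y.pos‖ := norm_pos_iff.2 (sub_ne_zero.2 fun e => h (Subtype.ext e))
  unfold hdist
  have : 0 < Real.arsinh (‖x.pos - y.pos‖ / √((1 - ‖x.pos‖ ^ 2) * (1 - ‖y.pos‖ ^ 2))) :=
    Real.arsinh_pos_iff.2 (by positivity)
  linarith

theorem hdist_eq_of_cosh {x y : H3} {s : ℝ} (hs : 0 ≤ s)
    (h : Real.cosh (hdist x y) = Real.cosh s) : hdist x y = s := by
  rw [← abs_of_nonneg (hdist_nonneg x y), ← abs_of_nonneg hs]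
  exact le_antisymm (Real.cosh_le_cosh.1 h.le) (Real.cosh_le_cosh.1 h.ge)

/-- Time coordinate of the corresponding point of the hyperboloid model. -/
noncomputable def liftT (x : H3) : ℝ := (1 + ‖x.pos‖ ^ 2) / (1 - ‖x.pos‖ ^ 2)

/-- Space coordinates of the corresponding point of the hyperboloid model. -/
noncomputable def liftV (x : H3) : E3 := (2 / (1 - ‖x.pos‖ ^ 2)) • x.pos

theorem liftT_pos (x : H3) : 0 < liftT x := by
  have hx := one_sub_normSq_pos x
  unfold liftT
  positivity

theorem lift_sq (x : H3) : liftT x ^ 2 - inner ℝ (liftV x) (liftV x) = 1 := by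
  have hx := one_sub_normSq_pos x
  simp only [liftT, liftV, inner_smul_left, inner_smul_right, real_inner_self_eq_norm_sq,
    conj_trivial]
  field_simp
  ring

theorem cosh_hdist_lift (x y : H3) :
    Real.cosh (hdist x y) = liftT x * liftT y - inner ℝ (liftV x) (liftV y) := by
  have hx := one_sub_normSq_pos x
  have hy := one_sub_normSq_pos y
  rw [cosh_hdist, norm_sub_sq_real]
  simp only [liftT, liftV, inner_smul_left, inner_smul_right, conj_trivial]
  field_simp
  ring

theorem exists_lift {T : ℝ} {V : E3} (hT : 0 < T) (h : T ^ 2 - inner ℝ V V = 1) :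
    ∃ z : H3, liftT z = T ∧ liftV z = V := by
  have hT1 : 0 < 1 + T := by linarith
  have hn : ‖(1 / (1 + T)) • V‖ ^ 2 = (T - 1) / (T + 1) := by
    rw [norm_smul, mul_pow, ← real_inner_self_eq_norm_sq V, Real.norm_of_nonneg (by positivity)]
    have : inner ℝ V V = (T - 1) * (T + 1) := by linarith
    rw [this]
    field_simp
    ring
  have hlt : ‖(1 / (1 + T)) • V‖ < 1 := by
    have : ‖(1 / (1 + T)) • V‖ ^ 2 < 1 := by
      rw [hn, div_lt_one (by linarith)]
      linarith
    exact lt_of_pow_lt_pow_left₀ 2 zero_le_one (by simpa using this)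
  have hT2 : T + 1 ≠ 0 := by linarith
  have h1 : 1 - (T - 1) / (T + 1) = 2 / (T + 1) := by
    field_simp
    ring
  refine ⟨⟨(1 / (1 + T)) • V, hlt⟩, ?_, ?_⟩
  · simp only [liftT, H3.pos]
    rw [hn, h1]
    field_simp
    ring
  · simp only [liftV, H3.pos]
    rw [hn, h1, smul_smul]
    have : 2 / (2 / (T + 1)) * (1 / (1 + T)) = 1 := by
      field_simp
      ring
    rw [this, one_smul]

/-- Geodesic segments of `H³` can be prolonged by any length. -/
theorem exists_prolong {x y : H3} (h : x ≠ y) {s : ℝ} (hs : 0 ≤ s) :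
    ∃ z ∈ hray x y, hdist x z = hdist x y + s := by
  have hD := hdist_pos h
  set D := hdist x y with hDdef
  have hS : 0 < Real.sinh D := Real.sinh_pos_iff.2 hD
  set p := Real.sinh (D + s) / Real.sinh D with hp
  set q := Real.sinh s / Real.sinh D with hq
  have hc : Real.cosh D = liftT x * liftT y - inner ℝ (liftV x) (liftV y) := cosh_hdist_lift x y
  have hx2 := lift_sq x
  have hy2 := lift_sq y
  have hcomm : inner ℝ (liftV y) (liftV x) = inner ℝ (liftV x) (liftV y) := real_inner_comm _ _
  have e1 : p - q * Real.cosh D = Real.cosh s := by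
    rw [hp, hq, Real.sinh_add]
    field_simp
    ring
  have e2 : p * Real.cosh D - q = Real.cosh (D + s) := by
    rw [hp, hq, Real.sinh_add, Real.cosh_add]
    field_simp
    linear_combination Real.sinh s * Real.cosh_sq D
  have e4 : q * Real.sinh D = Real.sinh s := by
    rw [hq]
    field_simp
  have e3 : p ^ 2 + q ^ 2 - 2 * p * q * Real.cosh D = 1 := by
    have hp' : p = Real.cosh s + q * Real.cosh D := by linarith
    rw [hp']
    linear_combination Real.cosh_sq s - q ^ 2 * Real.cosh_sq D
      - (q * Real.sinh D + Real.sinh s) * e4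
  set T := p * liftT y - q * liftT x with hT
  set V := p • liftV y - q • liftV x with hV
  have hVV : T ^ 2 - inner ℝ V V = 1 := by
    rw [hT, hV]
    simp only [inner_sub_left, inner_sub_right, inner_smul_left, inner_smul_right, conj_trivial,
      hcomm]
    linear_combination e3 + p ^ 2 * hy2 + q ^ 2 * hx2 + 2 * p * q * hc
  have hxV : liftT x * T - inner ℝ (liftV x) V = Real.cosh (D + s) := by
    rw [hT, hV]
    simp only [inner_sub_right, inner_smul_right]
    linear_combination e2 - p * hc - q * hx2
  have hyV : liftT y * T - inner ℝ (liftV y) V = Real.cosh s := by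
    rw [hT, hV]
    simp only [inner_sub_right, inner_smul_right, hcomm]
    linear_combination e1 + p * hy2 + q * hc
  have hTpos : 0 < T := by
    by_contra hneg
    have hneg : T ≤ 0 := not_lt.1 hneg
    have hx0 := liftT_pos x
    have hCS := abs_real_inner_le_norm (liftV x) V
    have h1 : ‖liftV x‖ ≤ liftT x := by
      rw [real_inner_self_eq_norm_sq] at hx2
      exact le_of_sq_le_sq (by linarith) hx0.le
    have h2 : ‖V‖ ≤ -T := by
      rw [real_inner_self_eq_norm_sq] at hVV
      exact le_of_sq_le_sq (by linarith [neg_sq T]) (by linarith)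
    have h3 : ‖liftV x‖ * ‖V‖ ≤ liftT x * -T := by gcongr
    have h4 := neg_abs_le (inner ℝ (liftV x) V)
    have h5 := Real.cosh_pos (D + s)
    linarith
  obtain ⟨z, hzT, hzV⟩ := exists_lift hTpos hVV
  have dx : hdist x z = D + s := hdist_eq_of_cosh (by linarith) (by
    rw [cosh_hdist_lift, hzT, hzV, hxV])
  have dy : hdist y z = s := hdist_eq_of_cosh hs (by rw [cosh_hdist_lift, hzT, hzV, hyV])
  refine ⟨z, Or.inr ?_, dx⟩
  unfold HBetween
  rw [dx, dy]

theorem exists_isRayLimit {x y : H3} (h : x ≠ y) : ∃ ξ : E3, IsRayLimit x y ξ := by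
  set K := closure (H3.pos '' hray x y) with hK
  have hsub : H3.pos '' hray x y ⊆ Metric.closedBall 0 1 := by
    rintro _ ⟨z, -, rfl⟩
    simpa using z.norm_pos_lt.le
  have hKsub : K ⊆ Metric.closedBall 0 1 := closure_minimal hsub Metric.isClosed_closedBall
  have hKc : IsCompact K := (isCompact_closedBall (0 : E3) 1).of_isClosed_subset isClosed_closure
    hKsub
  obtain ⟨z₀, hz₀, -⟩ := exists_prolong h le_rfl
  obtain ⟨ξ, hξ, hmax⟩ := hKc.exists_isMaxOn ⟨z₀.pos, subset_closure ⟨z₀, hz₀, rfl⟩⟩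
    continuous_norm.continuousOn
  refine ⟨ξ, ?_, hξ⟩
  have hle : ‖ξ‖ ≤ 1 := by simpa using hKsub hξ
  by_contra hne
  have hlt : ‖ξ‖ < 1 := lt_of_le_of_ne hle hne
  have hr : 0 < 1 - ‖ξ‖ ^ 2 := by nlinarith [norm_nonneg ξ]
  have hx := one_sub_normSq_pos x
  set M := 1 + 8 / ((1 - ‖x.pos‖ ^ 2) * (1 - ‖ξ‖ ^ 2)) with hM
  have hMpos : 0 ≤ M := by positivity
  obtain ⟨z, hz, hd⟩ := exists_prolong h hMpos
  have hzξ : ‖z.pos‖ ≤ ‖ξ‖ := hmax (subset_closure ⟨z, hz, rfl⟩ : z.pos ∈ K)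
  have hzx : ‖x.pos - z.pos‖ ≤ 2 := by
    linarith [norm_sub_le x.pos z.pos, x.norm_pos_lt, z.norm_pos_lt]
  have h1 : Real.cosh (hdist x z) ≤ M := by
    rw [cosh_hdist, hM]
    have hsq : 2 * ‖x.pos - z.pos‖ ^ 2 ≤ 8 := by nlinarith [norm_nonneg (x.pos - z.pos)]
    gcongr
  have h2 : hdist x z < Real.cosh (hdist x z) := by
    have := Real.add_one_le_exp (hdist x z)
    have h3 := Real.self_le_sinh_iff.2 (hdist_nonneg x z)
    linarith [Real.sinh_lt_cosh (hdist x z)]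
  linarith [hdist_nonneg x y]

/-- The limit point on the sphere at infinity of the ray based at `x` and passing through `y`. -/
noncomputable def rayLimit {x y : H3} (h : x ≠ y) : SphereAtInfinity :=
  ⟨(exists_isRayLimit h).choose, mem_sphere_zero_iff_norm.2 (exists_isRayLimit h).choose_spec.1⟩

open Classical in
/-- The identification of the sphere at infinity with the Riemann sphere `ℂ ∪ {∞}`:
stereographic projection from the north pole. -/
noncomputable def toRiemannSphere (ξ : SphereAtInfinity) : OnePoint ℂ :=
  if ξ.1 2 = 1 then OnePoint.infty
  else OnePoint.some (((ξ.1 0 : ℂ) + (ξ.1 1 : ℂ) * Complex.I) / (1 - (ξ.1 2 : ℂ)))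

/-- A configuration of `n` distinct points of `H³`. -/
abbrev Configuration (n : ℕ) : Type := Fin n ↪ H3

/-- The point `t i j` of the Riemann sphere: end point of the ray from `x i` through `x j`. -/
noncomputable def Configuration.root {n : ℕ} (x : Configuration n) {i j : Fin n} (h : i ≠ j) :
    OnePoint ℂ :=
  toRiemannSphere (rayLimit (x.injective.ne h))

/-- The polynomial of formal degree one with the given root on the Riemann sphere: `t - z` for a
finite root `z`, the constant `1` for the root `∞`. -/
noncomputable def linearFactor (t : OnePoint ℂ) : ℂ[X] :=
  t.elim 1 (fun z => X - C z)

/-- `p` is a polynomial of formal degree `n - 1` whose roots on the Riemann sphere are the points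
`t i j`, `j ≠ i`, with multiplicity (the root `∞` lowers the degree). Such a polynomial is
determined up to a nonzero scalar factor. -/
def Configuration.IsPolynomial {n : ℕ} (x : Configuration n) (i : Fin n) (p : ℂ[X]) : Prop :=
  ∃ c : ℂ, c ≠ 0 ∧ p = C c * ∏ j : {j : Fin n // i ≠ j}, linearFactor (x.root j.2)

/-- The polynomials of the configuration are linearly independent over `ℂ`, however the scalar
factors are chosen. -/
def Configuration.AHC {n : ℕ} (x : Configuration n) : Prop :=
  ∀ p : Fin n → ℂ[X], (∀ i, x.IsPolynomial i (p i)) → LinearIndependent ℂ p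

/-- A hyperbolic plane of the Poincaré ball: the part inside the ball of a Euclidean plane through
the centre (`a = 0`) or of a sphere orthogonal to the unit sphere (`a ≠ 0`, with centre `b / a`
and squared radius `‖b / a‖² - 1`). -/
def IsHyperbolicPlane (S : Set H3) : Prop :=
  ∃ (a : ℝ) (b : E3), |a| < ‖b‖ ∧ S = {z | a * (‖z.pos‖ ^ 2 + 1) = 2 * inner ℝ b z.pos}

/-- The points of the configuration lie in one hyperbolic plane. -/
def Configuration.Coplanar {n : ℕ} (x : Configuration n) : Prop :=
  ∃ S : Set H3, IsHyperbolicPlane S ∧ ∀ i, x i ∈ S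

/-- A set is hyperbolically convex if it contains the geodesic segment between any two of its
points. -/
def HConvex (S : Set H3) : Prop :=
  ∀ x ∈ S, ∀ z ∈ S, ∀ y, HBetween x y z → y ∈ S

/-- The hyperbolic convex hull: the smallest hyperbolically convex set containing `S`. -/
def hconvexHull (S : Set H3) : Set H3 := ⋂₀ {K | HConvex K ∧ S ⊆ K}

end AtiyahHyperbolic

/-!
Lift the points to the hyperboloid in Minkowski space, viewed as the space of Hermitian forms on
`ℂ²`: a point `x i` becomes a positive definite form `F i`. With `λ = exp (-d)` for the distance `d`
of `x i` and `x j`, the form `F j - λ F i` is null, hence `z ↦ |ω(z, v i j)|²` for the symplectic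
form `ω` and a vector `v i j` that represents the end point `t i j`. The cubic `p i` becomes
`z ↦ ∏ j, ω(z, v i j)`.

*General position.* If the cubics are dependent, a nonzero functional on cubics kills all of them.
By Sylvester (`exists_cubicFunctional_eq`) it is in general a combination of the evaluations at two
points `a`, `b`, so `∏ j, |ω(a, v i j)|² = κ ∏ j, |ω(b, v i j)|²` for all `i`. The level
sets of `r i = F i a / F i b` are disjoint planes, each crossed at most once by a geodesic; so for
`i` with `r i` maximal the factors with index `j` on the two sides have ratio at most `r j`, and
`κ ≤ ∏ j ≠ i, r j`. For the minimal `r i` the inequality is reversed. Hence all `r i` agree, and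
`F i a = r F i b` puts the four points in one plane. The degenerate functionals, which involve a
derivative at one point, are treated in the same way with a sum instead of a product
(`RayForms.eq_zero_of_functional_eq_zero`).

*A point in the hull of the others.* If `F o` is a nonnegative combination of the other forms and
the end points `r j` of the three rays from `x o` are distinct, the three end points `t i j` of the
rays from another point `x i` lie on the circle through the `r j`, on the arc away from `r i`.
Ptolemy's theorem (`symp_ptolemy`) then says that the matrix of the values of the three outer cubics
at the `r j`, suitably scaled, is strictly diagonally dominant (`RayForms.dominance`). If two of the
`r j` agree, all points lie on one geodesic and the cubics are monomials in two linear forms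
(`RayForms.eq_zero_of_collinear`).
-/

namespace AtiyahHyperbolic

/-! ### The hyperboloid model and end points of rays -/

/-- Minkowski space `ℝ × E3`: a time coordinate and three space coordinates. -/
abbrev Minkowski : Type := ℝ × E3

/-- The Lorentzian bilinear form of signature `(1, 3)`. -/
noncomputable def mink (X Y : Minkowski) : ℝ := X.1 * Y.1 - inner ℝ X.2 Y.2

/-- The point of the upper sheet of the hyperboloid `mink X X = 1` that corresponds to a point of
the ball. -/
noncomputable def lift (x : H3) : Minkowski := (liftT x, liftV x)

theorem mink_comm (X Y : Minkowski) : mink X Y = mink Y X := by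
  unfold mink
  rw [mul_comm, real_inner_comm]

theorem mink_sub_left (X Y Z : Minkowski) : mink (X - Y) Z = mink X Z - mink Y Z := by
  simp only [mink, Prod.fst_sub, Prod.snd_sub, inner_sub_left]
  ring

theorem mink_smul_left (c : ℝ) (X Y : Minkowski) : mink (c • X) Y = c * mink X Y := by
  simp only [mink, Prod.smul_fst, Prod.smul_snd, inner_smul_left, smul_eq_mul, conj_trivial]
  ring

theorem mink_sub_right (X Y Z : Minkowski) : mink X (Y - Z) = mink X Y - mink X Z := by
  rw [mink_comm, mink_sub_left, mink_comm Y, mink_comm Z]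

theorem mink_smul_right (c : ℝ) (X Y : Minkowski) : mink X (c • Y) = c * mink X Y := by
  rw [mink_comm, mink_smul_left, mink_comm]

theorem mink_lift_self (x : H3) : mink (lift x) (lift x) = 1 := by
  have := lift_sq x
  simp only [mink, lift]
  linarith

theorem mink_lift (x y : H3) : mink (lift x) (lift y) = Real.cosh (hdist x y) :=
  (cosh_hdist_lift x y).symm

theorem hdist_comm (x y : H3) : hdist x y = hdist y x := by
  unfold hdist
  rw [norm_sub_rev, mul_comm (1 - ‖x.pos‖ ^ 2)]

theorem norm_liftV_lt (x : H3) : ‖liftV x‖ < liftT x := by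
  have h := lift_sq x
  rw [real_inner_self_eq_norm_sq] at h
  exact lt_of_pow_lt_pow_left₀ 2 (liftT_pos x).le (by linarith)

/-- The orthogonal complement of a timelike vector contains no nonzero null vector. -/
theorem eq_zero_of_null_of_orthogonal {W : Minkowski} (x : H3) (hW : mink W W = 0)
    (hx : mink W (lift x) = 0) : W = 0 := by
  have hlt := norm_liftV_lt x
  have h1 : |W.1| = ‖W.2‖ := by
    rw [mink, real_inner_self_eq_norm_sq] at hW
    rw [← abs_of_nonneg (norm_nonneg W.2)]
    exact (sq_eq_sq_iff_abs_eq_abs _ _).1 (by linarith)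
  have h2 : W.1 * liftT x = inner ℝ W.2 (liftV x) := by
    simp only [mink, lift] at hx
    linarith
  have h3 := abs_real_inner_le_norm W.2 (liftV x)
  rw [← h2, abs_mul, abs_of_pos (liftT_pos x), h1] at h3
  have h4 : ‖W.2‖ = 0 := by
    by_contra hne
    have hpos : 0 < ‖W.2‖ := lt_of_le_of_ne (norm_nonneg _) (Ne.symm hne)
    nlinarith
  rw [h4, abs_eq_zero] at h1
  exact Prod.ext h1 (norm_eq_zero.1 h4)

/-- Points on a common geodesic have linearly dependent lifts, with explicit coefficients. -/
theorem HBetween.sinh_smul_lift {x y z : H3} (h : HBetween x y z) :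
    Real.sinh (hdist x z) • lift y =
      Real.sinh (hdist y z) • lift x + Real.sinh (hdist x y) • lift z := by
  have hxz : hdist x z = hdist x y + hdist y z := h.symm
  have c1 := mink_lift x y
  have c2 := mink_lift y z
  have c3 := mink_lift x z
  have c1' := mink_lift y x
  have c2' := mink_lift z y
  have c3' := mink_lift z x
  rw [hdist_comm] at c1' c2' c3'
  rw [hxz] at c3 c3' ⊢
  set D := hdist x y
  set s := hdist y z
  have key : Real.sinh (D + s) • lift y - Real.sinh s • lift x - Real.sinh D • lift z = 0 := by
    refine eq_zero_of_null_of_orthogonal y ?_ ?_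
    · simp only [mink_sub_left, mink_sub_right, mink_smul_left, mink_smul_right, mink_lift_self,
        c1, c2, c3, c1', c2', c3', Real.sinh_add, Real.cosh_add]
      linear_combination (-Real.sinh D ^ 2) * Real.cosh_sq s - Real.sinh s ^ 2 * Real.cosh_sq D
    · simp only [mink_sub_left, mink_smul_left, mink_lift_self, c1, c2', Real.sinh_add]
      ring
  rw [sub_sub, sub_eq_zero] at key
  exact key

/-- The lift of a point of the ray from `x` through `y` is a combination `p • Y - q • X` with
`p ≥ 0` and `q ≤ p`. -/
theorem exists_lift_eq_of_mem_hray {x y z : H3} (hxy : x ≠ y) (hz : z ∈ hray x y) :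
    ∃ p q : ℝ, 0 ≤ p ∧ q ≤ p ∧ lift z = p • lift y - q • lift x := by
  have hD : 0 < Real.sinh (hdist x y) := Real.sinh_pos_iff.2 (hdist_pos hxy)
  have h1 : 0 ≤ Real.sinh (hdist x z) := Real.sinh_nonneg_iff.2 (hdist_nonneg x z)
  have hp : 0 ≤ Real.sinh (hdist x z) / Real.sinh (hdist x y) := by positivity
  rcases hz with h | h
  · have h2 : 0 ≤ Real.sinh (hdist z y) := Real.sinh_nonneg_iff.2 (hdist_nonneg z y)
    have h3 : 0 ≤ Real.sinh (hdist z y) / Real.sinh (hdist x y) := by positivity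
    refine ⟨_, -(Real.sinh (hdist z y) / Real.sinh (hdist x y)), hp, by linarith, ?_⟩
    have := congrArg (fun W => (Real.sinh (hdist x y))⁻¹ • W) h.sinh_smul_lift
    simp only [smul_smul, smul_add, inv_mul_cancel₀ hD.ne', one_smul] at this
    rw [this, div_eq_inv_mul, div_eq_inv_mul, neg_smul, sub_neg_eq_add, add_comm]
  · refine ⟨_, Real.sinh (hdist y z) / Real.sinh (hdist x y), hp, ?_, ?_⟩
    · refine (div_le_div_iff_of_pos_right hD).2 (Real.sinh_le_sinh.2 ?_)
      rw [← (h : hdist x y + hdist y z = hdist x z)]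
      linarith [hdist_nonneg x y]
    · have := congrArg (fun W => (Real.sinh (hdist x y))⁻¹ • W) h.sinh_smul_lift
      simp only [smul_smul, smul_add, inv_mul_cancel₀ hD.ne', one_smul] at this
      rw [div_eq_inv_mul, div_eq_inv_mul, this, add_sub_cancel_left]

/-- The limit point `ξ` of the ray from `x` through `y` spans the future null direction of the
plane of `lift x` and `lift y` that lies on the side of `lift y`. -/
theorem IsRayLimit.exists_smul {x y : H3} {ξ : E3} (hxy : x ≠ y) (h : IsRayLimit x y ξ) :
    ∃ s : ℝ, 0 < s ∧ lift y - Real.exp (-hdist x y) • lift x = s • ((1, ξ) : Minkowski) := by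
  set C := Real.cosh (hdist x y) with hC
  have hD := hdist_pos hxy
  have hS : 0 < Real.sinh (hdist x y) := Real.sinh_pos_iff.2 hD
  have hC2 : C ^ 2 - 1 ≠ 0 := by
    rw [hC, Real.cosh_sq]
    have : 0 < Real.sinh (hdist x y) ^ 2 := by positivity
    linarith
  have cxy : mink (lift x) (lift y) = C := mink_lift x y
  have cyx : mink (lift y) (lift x) = C := by rw [mink_comm, cxy]
  -- `vec ζ` is the lift of `ζ` rescaled so as to be continuous up to the sphere.
  let vec : E3 → Minkowski := fun ζ => (1 + ‖ζ‖ ^ 2, (2 : ℝ) • ζ)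
  let P : E3 → ℝ := fun ζ => (C * mink (vec ζ) (lift x) - mink (vec ζ) (lift y)) / (C ^ 2 - 1)
  let Q : E3 → ℝ := fun ζ => (mink (vec ζ) (lift x) - C * mink (vec ζ) (lift y)) / (C ^ 2 - 1)
  have hvec : Continuous vec := by fun_prop
  have hm : ∀ X : Minkowski, Continuous fun ζ => mink (vec ζ) X := fun X => by
    unfold mink
    fun_prop
  have hP : Continuous P := by
    have h1 := hm (lift x)
    have h2 := hm (lift y)
    fun_prop
  have hQ : Continuous Q := by
    have h1 := hm (lift x)
    have h2 := hm (lift y)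
    fun_prop
  let S : Set E3 := {ζ | 0 ≤ P ζ ∧ Q ζ ≤ P ζ ∧ vec ζ = P ζ • lift y - Q ζ • lift x}
  have hS : IsClosed S := by
    refine (isClosed_le continuous_const hP).inter ((isClosed_le hQ hP).inter ?_)
    exact isClosed_eq hvec ((hP.smul continuous_const).sub (hQ.smul continuous_const))
  have hsub : H3.pos '' hray x y ⊆ S := by
    rintro _ ⟨z, hz, rfl⟩
    obtain ⟨p, q, hp, hqp, hpq⟩ := exists_lift_eq_of_mem_hray hxy hz
    have hz1 := one_sub_normSq_pos z
    have e : vec z.pos = (1 - ‖z.pos‖ ^ 2) • lift z := by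
      simp only [vec, lift, liftT, liftV, Prod.smul_mk, smul_smul, smul_eq_mul,
        mul_div_cancel₀ _ hz1.ne']
    have e' : vec z.pos = ((1 - ‖z.pos‖ ^ 2) * p) • lift y - ((1 - ‖z.pos‖ ^ 2) * q) • lift x := by
      rw [e, hpq, smul_sub, smul_smul, smul_smul]
    have eP : P z.pos = (1 - ‖z.pos‖ ^ 2) * p := by
      simp only [P]
      rw [div_eq_iff hC2, e']
      simp only [mink_sub_left, mink_smul_left, cxy, cyx, mink_lift_self]
      ring
    have eQ : Q z.pos = (1 - ‖z.pos‖ ^ 2) * q := by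
      simp only [Q]
      rw [div_eq_iff hC2, e']
      simp only [mink_sub_left, mink_smul_left, cxy, cyx, mink_lift_self]
      ring
    refine ⟨?_, ?_, ?_⟩
    · rw [eP]
      positivity
    · rw [eP, eQ]
      gcongr
    · rw [eP, eQ, e']
  obtain ⟨h0, hQP, hξ⟩ := closure_minimal hsub hS h.2
  have hvecξ : vec ξ = (2 : ℝ) • ((1, ξ) : Minkowski) := by
    simp only [vec, h.1, Prod.smul_mk]
    norm_num
  have hnull : mink (vec ξ) (vec ξ) = 0 := by
    rw [hvecξ, mink_smul_left, mink_smul_right]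
    simp [mink, h.1]
  rw [hξ] at hnull
  simp only [mink_sub_left, mink_sub_right, mink_smul_left, mink_smul_right, cxy, cyx,
    mink_lift_self] at hnull
  generalize P ξ = p at *
  generalize Q ξ = q at *
  set l := Real.exp (-hdist x y) with hl
  have hl0 : 0 < l := Real.exp_pos _
  have hl1 : l < 1 := Real.exp_lt_one_iff.2 (by linarith)
  have hCl : 2 * C * l = l ^ 2 + 1 := by
    rw [hC, Real.cosh_eq, ← hl]
    have : Real.exp (hdist x y) * l = 1 := by rw [hl, ← Real.exp_add]; simp
    linear_combination this
  have hp0 : p ≠ 0 := by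
    intro hp
    have hq : q = 0 := by
      have : q ^ 2 = 0 := by rw [hp] at hnull; linear_combination hnull
      exact pow_eq_zero_iff (two_ne_zero) |>.1 this
    rw [hp, hq, hvecξ] at hξ
    have := congrArg Prod.fst hξ
    simp at this
  have hp : 0 < p := lt_of_le_of_ne h0 hp0.symm
  have hfac : (q - l * p) * (l * q - p) = 0 := by
    linear_combination l * hnull + p * q * hCl
  have hql : q = l * p := by
    rcases mul_eq_zero.1 hfac with h' | h'
    · linarith
    · have : l * q ≤ l * p := by gcongr
      nlinarith
  refine ⟨2 / p, by positivity, ?_⟩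
  have e : p • (lift y - l • lift x) = (2 : ℝ) • ((1, ξ) : Minkowski) := by
    rw [← hvecξ, hξ, hql, smul_sub, smul_smul, mul_comm l]
  rw [div_eq_inv_mul, mul_smul, ← e, smul_smul, inv_mul_cancel₀ hp0, one_smul]

/-! ### Coplanarity and convex hulls in the hyperboloid model -/

/-- A nonzero linear functional on Minkowski space that vanishes at points of the hyperboloid cuts
out a hyperbolic plane: its kernel contains a timelike vector, so its normal is spacelike. -/
theorem coplanar_of_functional {n : ℕ} (x : Configuration n) (i₀ : Fin n)
    (Φ : Minkowski →ₗ[ℝ] ℝ) (hΦ : Φ ≠ 0) (h : ∀ i, Φ (lift (x i)) = 0) : x.Coplanar := by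
  let φ : E3 →ₗ[ℝ] ℝ := Φ ∘ₗ LinearMap.inr ℝ ℝ E3
  let b : E3 := (InnerProductSpace.toDual ℝ E3).symm φ.toContinuousLinearMap
  have hb : ∀ V, inner ℝ b V = Φ (0, V) := fun V => by
    simp [b, φ, InnerProductSpace.toDual_symm_apply]
  have hΦe : ∀ X : Minkowski, Φ X = X.1 * Φ (1, 0) + inner ℝ b X.2 := fun X => by
    rw [hb]
    conv_lhs => rw [show X = X.1 • ((1, 0) : Minkowski) + (0, X.2) by ext <;> simp]
    rw [map_add, map_smul, smul_eq_mul]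
  have hz : ∀ i, liftT (x i) * -Φ (1, 0) = inner ℝ b (liftV (x i)) := fun i => by
    have := h i
    rw [hΦe] at this
    simp only [lift] at this
    linarith
  refine ⟨{z | -Φ (1, 0) * (‖z.pos‖ ^ 2 + 1) = 2 * inner ℝ b z.pos}, ⟨_, b, ?_, rfl⟩, fun i => ?_⟩
  · have hT := liftT_pos (x i₀)
    have hlt := norm_liftV_lt (x i₀)
    have h3 := abs_real_inner_le_norm b (liftV (x i₀))
    rw [← hz i₀, abs_mul, abs_of_pos hT] at h3
    have hb0 : 0 < ‖b‖ := by
      rw [norm_pos_iff]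
      intro hb0
      apply hΦ
      have h4 := hz i₀
      rw [hb0, inner_zero_left] at h4
      have h5 : Φ (1, 0) = 0 := by
        rcases mul_eq_zero.1 h4 with h' | h'
        · exact absurd h' hT.ne'
        · linarith
      refine LinearMap.ext fun X => ?_
      rw [hΦe, h5, hb0]
      simp
    by_contra hle
    have : ‖b‖ ≤ |(-Φ (1, 0))| := not_lt.1 hle
    nlinarith
  · have h1 := one_sub_normSq_pos (x i)
    have h2 := hz i
    simp only [liftT, liftV, inner_smul_right] at h2
    field_simp at h2
    change _ = _
    linear_combination h2

/-- Points of a configuration that is not coplanar have linearly independent lifts. -/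
theorem linearIndependent_lift_of_not_coplanar (x : Configuration 4) (h : ¬ x.Coplanar) :
    LinearIndependent ℝ fun i => lift (x i) := by
  have hdim : Module.finrank ℝ Minkowski = 4 := by simp [Minkowski, E3]
  apply linearIndependent_of_top_le_span_of_card_eq_finrank
  · by_contra hlt
    obtain ⟨Φ, hΦ, hle⟩ := Submodule.exists_le_ker_of_lt_top _ (lt_top_iff_ne_top.2
      fun h' => hlt h'.ge)
    exact h (coplanar_of_functional x 0 Φ hΦ fun i =>
      LinearMap.mem_ker.1 (hle (Submodule.subset_span ⟨i, rfl⟩)))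
  · simp [hdim]

/-- Lifts of points of a hyperbolic convex hull are nonnegative combinations of lifts. -/
theorem exists_lift_eq_sum_of_mem_hconvexHull {ι : Type*} (s : Finset ι) (x : ι → H3) {z : H3}
    (hz : z ∈ hconvexHull (x '' s)) :
    ∃ m : ι → ℝ, (∀ i, 0 ≤ m i) ∧ lift z = ∑ i ∈ s, m i • lift (x i) := by
  classical
  let K : Set H3 := {z | ∃ m : ι → ℝ, (∀ i, 0 ≤ m i) ∧ lift z = ∑ i ∈ s, m i • lift (x i)}
  refine Set.mem_sInter.1 hz K ⟨?_, ?_⟩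
  · rintro u ⟨m, hm, hu⟩ v ⟨m', hm', hv⟩ y hy
    by_cases huv : u = v
    · have h1 := hy
      have huu : hdist v v = 0 := by simp [hdist]
      have hd := hdist_nonneg u y
      have hd' := hdist_nonneg y v
      have : y = v := by
        by_contra hne
        have := hdist_pos hne
        rw [HBetween, huv, huu] at h1
        rw [huv] at hd
        linarith
      exact this ▸ ⟨m', hm', hv⟩
    have hD : 0 < Real.sinh (hdist u v) := Real.sinh_pos_iff.2 (hdist_pos huv)
    have h1 : 0 ≤ Real.sinh (hdist y v) := Real.sinh_nonneg_iff.2 (hdist_nonneg _ _)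
    have h2 : 0 ≤ Real.sinh (hdist u y) := Real.sinh_nonneg_iff.2 (hdist_nonneg _ _)
    refine ⟨fun i => (Real.sinh (hdist u v))⁻¹ *
      (Real.sinh (hdist y v) * m i + Real.sinh (hdist u y) * m' i), fun i => ?_, ?_⟩
    · have := hm i
      have := hm' i
      positivity
    · have := congrArg (fun W => (Real.sinh (hdist u v))⁻¹ • W) hy.sinh_smul_lift
      simp only [smul_smul, inv_mul_cancel₀ hD.ne', one_smul] at this
      rw [this, hu, hv]
      simp only [mul_smul, add_smul, Finset.smul_sum, ← Finset.sum_add_distrib, smul_add]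
  · rintro _ ⟨i, hi, rfl⟩
    refine ⟨fun j => if j = i then 1 else 0, fun j => by positivity, ?_⟩
    simp only [ite_smul, one_smul, zero_smul]
    rw [Finset.sum_ite_eq' s i]
    exact (if_pos hi).symm

/-! ### The symplectic plane -/

/-- The symplectic form of `ℂ²`; `symp z v` vanishes exactly when `z` and `v` are proportional
(for nonzero vectors). -/
def symp (z v : ℂ × ℂ) : ℂ := z.1 * v.2 - z.2 * v.1

theorem symp_self (z : ℂ × ℂ) : symp z z = 0 := by
  unfold symp
  ring

theorem symp_swap (z v : ℂ × ℂ) : symp v z = -symp z v := by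
  unfold symp
  ring

theorem normSq_symp_comm (z v : ℂ × ℂ) : Complex.normSq (symp v z) = Complex.normSq (symp z v) := by
  rw [symp_swap, Complex.normSq_neg]

theorem norm_symp_comm (z v : ℂ × ℂ) : ‖symp v z‖ = ‖symp z v‖ := by
  rw [symp_swap, norm_neg]

theorem symp_add_left (a b v : ℂ × ℂ) : symp (a + b) v = symp a v + symp b v := by
  simp only [symp, Prod.fst_add, Prod.snd_add]
  ring

theorem symp_sub_left (a b v : ℂ × ℂ) : symp (a - b) v = symp a v - symp b v := by
  simp only [symp, Prod.fst_sub, Prod.snd_sub]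
  ring

theorem symp_neg_left (a v : ℂ × ℂ) : symp (-a) v = -symp a v := by
  simp only [symp, Prod.fst_neg, Prod.snd_neg]
  ring

theorem symp_smul_left (s : ℂ) (z v : ℂ × ℂ) : symp (s • z) v = s * symp z v := by
  simp only [symp, Prod.smul_fst, Prod.smul_snd, smul_eq_mul]
  ring

theorem symp_smul_right (s : ℂ) (z v : ℂ × ℂ) : symp z (s • v) = s * symp z v := by
  simp only [symp, Prod.smul_fst, Prod.smul_snd, smul_eq_mul]
  ring

theorem ne_zero_of_symp_ne_zero {a b : ℂ × ℂ} (h : symp a b ≠ 0) : a ≠ 0 ∧ b ≠ 0 :=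
  ⟨by rintro rfl; simp [symp] at h, by rintro rfl; simp [symp] at h⟩

theorem exists_smul_of_symp_eq_zero {a v : ℂ × ℂ} (ha : a ≠ 0) (hv : v ≠ 0) (h : symp a v = 0) :
    ∃ s : ℂ, s ≠ 0 ∧ v = s • a := by
  unfold symp at h
  have key : ∃ s : ℂ, v = s • a := by
    by_cases h1 : a.1 = 0
    · have h2 : a.2 ≠ 0 := fun h2 => ha (Prod.ext h1 h2)
      refine ⟨v.2 / a.2, Prod.ext ?_ ?_⟩
      · have : a.2 * v.1 = 0 := by
          rw [h1] at h
          linear_combination -h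
        simp [h1, (mul_eq_zero.1 this).resolve_left h2]
      · simp [h2]
    · refine ⟨v.1 / a.1, Prod.ext ?_ ?_⟩
      · simp [h1]
      · simp only [Prod.smul_snd, smul_eq_mul]
        field_simp
        linear_combination h
  obtain ⟨s, rfl⟩ := key
  exact ⟨s, fun hs => hv (by rw [hs, zero_smul]), rfl⟩

theorem symp_ne_zero_of_not_both {a b v : ℂ × ℂ} (hab : symp a b ≠ 0) (hv : v ≠ 0)
    (h : symp b v = 0) : symp a v ≠ 0 := by
  obtain ⟨s, hs, rfl⟩ := exists_smul_of_symp_eq_zero (ne_zero_of_symp_ne_zero hab).2 hv h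
  rw [symp_smul_right]
  exact mul_ne_zero hs hab

/-- Finitely many nonzero vectors of `ℂ²` have a common vector proportional to none of them. -/
theorem exists_symp_ne_zero {ι : Type*} (s : Finset ι) (v : ι → ℂ × ℂ) (hv : ∀ i ∈ s, v i ≠ 0) :
    ∃ z : ℂ × ℂ, z ≠ 0 ∧ ∀ i ∈ s, symp z (v i) ≠ 0 := by
  classical
  obtain ⟨t, ht⟩ := Infinite.exists_notMem_finset (s.image fun i => (v i).2 / (v i).1)
  refine ⟨(1, t), by simp, fun i hi h => ?_⟩
  simp only [symp, one_mul] at h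
  by_cases h1 : (v i).1 = 0
  · exact hv i hi (Prod.ext h1 (by simpa [h1] using h))
  · refine ht (Finset.mem_image.2 ⟨i, hi, ?_⟩)
    field_simp
    linear_combination h

/-! ### Functionals on binary cubics -/

/-- The functional with values `q k` on the monomials `t ^ k`, evaluated on the cubic with the
three roots represented by `u`, `v`, `w`. -/
def cubicFunctional (q : Fin 4 → ℂ) (u v w : ℂ × ℂ) : ℂ :=
  -q 0 * (u.1 * v.1 * w.1) + q 1 * (u.2 * v.1 * w.1 + u.1 * v.2 * w.1 + u.1 * v.1 * w.2)
    - q 2 * (u.2 * v.2 * w.1 + u.2 * v.1 * w.2 + u.1 * v.2 * w.2) + q 3 * (u.2 * v.2 * w.2)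

/-- Sylvester: a functional on binary cubics is a combination of the evaluations at two points, or
of the evaluation at a point and a derivative there. -/
theorem exists_cubicFunctional_eq (q : Fin 4 → ℂ) :
    ∃ (a b : ℂ × ℂ) (α β : ℂ), symp a b ≠ 0 ∧
      ((∀ u v w, cubicFunctional q u v w =
          α * (symp a u * symp a v * symp a w) + β * (symp b u * symp b v * symp b w)) ∨
        ∀ u v w, cubicFunctional q u v w = α * (symp a u * symp a v * symp a w) +
          β * (symp b u * symp a v * symp a w + symp a u * symp b v * symp a w +
            symp a u * symp a v * symp b w)) := by
  -- The points are the roots of a quadratic in the kernel of the Hankel matrix of `q`; the zero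
  -- row makes that matrix square.
  obtain ⟨h, hh, hk⟩ := (Matrix.exists_mulVec_eq_zero_iff
    (M := !![q 0, q 1, q 2; q 1, q 2, q 3; 0, 0, 0])).2 (by simp [Matrix.det_fin_three])
  have e0 := congrFun hk 0
  have e1 := congrFun hk 1
  simp [Matrix.mulVec, dotProduct, Fin.sum_univ_three] at e0 e1
  by_cases h2 : h 2 = 0
  · by_cases h1 : h 1 = 0
    · have h0 : h 0 ≠ 0 := fun h0 => hh (by ext i; fin_cases i <;> simp [h0, h1, h2])
      simp [h1, h2, h0] at e0 e1
      refine ⟨(1, 0), (0, 1), q 3, q 2, by simp [symp], Or.inr fun u v w => ?_⟩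
      simp only [cubicFunctional, symp, e0, e1]
      ring
    · have r1 : q 1 = -(h 0 / h 1) * q 0 := by
        field_simp
        linear_combination e0 - q 2 * h2
      have r2 : q 2 = -(h 0 / h 1) * q 1 := by
        field_simp
        linear_combination e1 - q 3 * h2
      generalize -(h 0 / h 1) = ρ at r1 r2
      refine ⟨(ρ, 1), (1, 0), q 0, q 3 - ρ ^ 3 * q 0, by simp [symp], Or.inl fun u v w => ?_⟩
      simp only [cubicFunctional, symp, r1, r2]
      ring
  · obtain ⟨s, hs⟩ := IsAlgClosed.exists_pow_nat_eq (h 1 ^ 2 - 4 * h 0 * h 2) (n := 2) two_pos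
    obtain ⟨ρ, hρ⟩ : ∃ ρ, ρ = (-h 1 + s) / (2 * h 2) := ⟨_, rfl⟩
    obtain ⟨σ, hσ⟩ : ∃ σ, σ = (-h 1 - s) / (2 * h 2) := ⟨_, rfl⟩
    have hsum : h 2 * (ρ + σ) = -h 1 := by
      rw [hρ, hσ]
      field_simp
      ring
    have hprod : h 2 * (ρ * σ) = h 0 := by
      rw [hρ, hσ]
      field_simp
      linear_combination -hs
    have r2 : q 2 = (ρ + σ) * q 1 - ρ * σ * q 0 := by
      apply mul_left_cancel₀ h2
      linear_combination e0 - q 1 * hsum + q 0 * hprod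
    have r3 : q 3 = (ρ + σ) * q 2 - ρ * σ * q 1 := by
      apply mul_left_cancel₀ h2
      linear_combination e1 - q 2 * hsum + q 1 * hprod
    by_cases hne : ρ = σ
    · refine ⟨(ρ, 1), (1, 0), q 0, q 1 - ρ * q 0, by simp [symp], Or.inr fun u v w => ?_⟩
      simp only [cubicFunctional, symp, r3, r2, ← hne]
      ring
    · have hne' : ρ - σ ≠ 0 := sub_ne_zero.2 hne
      refine ⟨(ρ, 1), (σ, 1), (q 1 - σ * q 0) / (ρ - σ), (ρ * q 0 - q 1) / (ρ - σ),
        by simpa [symp] using hne', Or.inl fun u v w => ?_⟩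
      simp only [cubicFunctional, symp, r3, r2]
      field_simp
      ring

theorem eq_zero_of_cubicFunctional_eq_zero {q : Fin 4 → ℂ}
    (h : ∀ u v w, cubicFunctional q u v w = 0) : q = 0 := by
  have h0 := h (1, 0) (1, 0) (1, 0)
  have h1 := h (0, 1) (1, 0) (1, 0)
  have h2 := h (0, 1) (0, 1) (1, 0)
  have h3 := h (0, 1) (0, 1) (0, 1)
  simp [cubicFunctional] at h0 h1 h2 h3
  ext i
  fin_cases i <;> simp [h0, h1, h2, h3]

/-- The real part of a quotient by polarization, which expresses it through values of rank one
forms. -/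
theorem normSq_polarization (u w : ℂ) (hu : u ≠ 0) :
    Complex.normSq (u + w) - Complex.normSq (u - w) = 4 * (w / u).re * Complex.normSq u := by
  have hu' : Complex.normSq u ≠ 0 := (Complex.normSq_pos.2 hu).ne'
  rw [Complex.div_re]
  field_simp
  simp only [Complex.normSq_apply, Complex.add_re, Complex.add_im, Complex.sub_re, Complex.sub_im]
  ring

/-! ### Hermitian forms of four points -/

/-- The positive definite Hermitian forms `F i` on `ℂ²` attached to four points of `H³`, together
with vectors `v i j` representing the end points of the rays: `F j` minus a multiple of `F i` is the
rank one form of `v i j`. -/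
structure RayForms where
  /-- the Hermitian form of the point with index `i` -/
  F : Fin 4 → ℂ × ℂ → ℝ
  /-- the multipliers, `exp (-d)` for the distance `d` of the points -/
  lam : Fin 4 → Fin 4 → ℝ
  /-- representatives of the end points of the rays -/
  v : Fin 4 → Fin 4 → ℂ × ℂ
  F_pos : ∀ i z, z ≠ 0 → 0 < F i z
  lam_pos : ∀ i j, 0 < lam i j
  lam_lt_one : ∀ i j, i ≠ j → lam i j < 1
  lam_symm : ∀ i j, lam i j = lam j i
  v_ne_zero : ∀ i j, i ≠ j → v i j ≠ 0
  F_eq : ∀ i j z, i ≠ j → F j z = lam i j * F i z + Complex.normSq (symp z (v i j))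

theorem exists_others (i : Fin 4) : ∃ j k l : Fin 4, i ≠ j ∧ i ≠ k ∧ i ≠ l ∧ j ≠ k ∧ j ≠ l ∧
    k ≠ l ∧ Finset.univ.erase i = {j, k, l} := by
  revert i
  decide

theorem erase_eq_of_ne {o i j k : Fin 4} (h1 : o ≠ i) (h2 : o ≠ j) (h3 : o ≠ k) (h4 : i ≠ j)
    (h5 : i ≠ k) (h6 : j ≠ k) : Finset.univ.erase o = {i, j, k} := by
  symm
  apply Finset.eq_of_subset_of_card_le
  · intro a ha
    simp only [Finset.mem_insert, Finset.mem_singleton] at ha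
    rcases ha with rfl | rfl | rfl <;> simp [h1.symm, h2.symm, h3.symm]
  · simp [h4, h5, h6]

namespace RayForms

variable (D : RayForms)

theorem F_of_symp_eq_zero {i j : Fin 4} {z : ℂ × ℂ} (hij : i ≠ j) (h : symp z (D.v i j) = 0) :
    D.F j z = D.lam i j * D.F i z := by
  simp [D.F_eq i j z hij, h]

/-! ### Points in general position -/

/-- No point of the sphere at infinity is an end point of a ray from every point: consider the
first point in the order of the horospheres around it. -/
theorem exists_prod_symp_ne_zero {a : ℂ × ℂ} (ha : a ≠ 0) :
    ∃ i, ∏ j ∈ Finset.univ.erase i, symp a (D.v i j) ≠ 0 := by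
  obtain ⟨i, hi⟩ := Finite.exists_min fun i => D.F i a
  refine ⟨i, Finset.prod_ne_zero_iff.2 fun j hj h => ?_⟩
  have hij : i ≠ j := (Finset.ne_of_mem_erase hj).symm
  have h1 := D.F_of_symp_eq_zero hij h
  have h2 := D.lam_lt_one i j hij
  have h3 := D.F_pos i a ha
  nlinarith [hi j]

/-- A ray starting at a point where the ratio of the forms `F · a` and `F · b` is largest ends at a
point where that ratio is at most the one at any other point of the ray. -/
theorem le_prod_of_isMax {a b : ℂ × ℂ} (hab : symp a b ≠ 0) {κ : ℝ} {i : Fin 4}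
    (hκ : ∏ j ∈ Finset.univ.erase i, Complex.normSq (symp a (D.v i j)) =
      κ * ∏ j ∈ Finset.univ.erase i, Complex.normSq (symp b (D.v i j)))
    (hi : ∀ j, D.F j a / D.F j b ≤ D.F i a / D.F i b) :
    κ ≤ ∏ j ∈ Finset.univ.erase i, D.F j a / D.F j b := by
  obtain ⟨ha, hb⟩ := ne_zero_of_symp_ne_zero hab
  have hB : ∀ j ∈ Finset.univ.erase i, 0 < Complex.normSq (symp b (D.v i j)) := fun j hj => by
    have hij : i ≠ j := (Finset.ne_of_mem_erase hj).symm
    refine Complex.normSq_pos.2 fun h => ?_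
    have h1 := D.F_of_symp_eq_zero hij h
    have h2 := D.F_eq i j a hij
    have h3 := Complex.normSq_pos.2 (symp_ne_zero_of_not_both hab (D.v_ne_zero i j hij) h)
    have h4 := hi j
    have h5 := D.F_pos i b hb
    have h6 := D.lam_pos i j
    rw [h1, div_le_div_iff₀ (by positivity) h5, h2] at h4
    nlinarith [mul_pos h3 h5]
  have hle : ∀ j ∈ Finset.univ.erase i, Complex.normSq (symp a (D.v i j)) ≤
      D.F j a / D.F j b * Complex.normSq (symp b (D.v i j)) := fun j hj => by
    have hij : i ≠ j := (Finset.ne_of_mem_erase hj).symm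
    have h1 := D.F_eq i j a hij
    have h2 := D.F_eq i j b hij
    have h3 := D.F_pos j b hb
    have h4 := hi j
    have h5 := D.F_pos i b hb
    have h6 := D.lam_pos i j
    rw [div_le_div_iff₀ h3 h5] at h4
    rw [div_mul_eq_mul_div, le_div_iff₀ h3]
    have e1 : Complex.normSq (symp a (D.v i j)) = D.F j a - D.lam i j * D.F i a := by linarith
    have e2 : Complex.normSq (symp b (D.v i j)) = D.F j b - D.lam i j * D.F i b := by linarith
    rw [e1, e2]
    nlinarith [mul_le_mul_of_nonneg_left h4 h6.le]
  have hprod := Finset.prod_le_prod (fun j _ => Complex.normSq_nonneg (symp a (D.v i j))) hle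
  rw [hκ, Finset.prod_mul_distrib] at hprod
  exact le_of_mul_le_mul_right hprod (Finset.prod_pos hB)

/-- The points lie on one of the planes on which the ratio of the forms `F · a` and `F · b` is
constant: compare the points of largest and of smallest ratio. -/
theorem exists_ratio_of_prod_eq {a b : ℂ × ℂ} (hab : symp a b ≠ 0) {κ : ℝ} (hκ0 : 0 < κ)
    (hκ : ∀ i, ∏ j ∈ Finset.univ.erase i, Complex.normSq (symp a (D.v i j)) =
      κ * ∏ j ∈ Finset.univ.erase i, Complex.normSq (symp b (D.v i j))) :
    ∃ r : ℝ, ∀ i, D.F i a = r * D.F i b := by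
  obtain ⟨ha, hb⟩ := ne_zero_of_symp_ne_zero hab
  have hba : symp b a ≠ 0 := by rwa [symp_swap, neg_ne_zero]
  have hr : ∀ i, 0 < D.F i a / D.F i b := fun i => div_pos (D.F_pos i a ha) (D.F_pos i b hb)
  obtain ⟨i, hi⟩ := Finite.exists_max fun i => D.F i a / D.F i b
  obtain ⟨k, hk⟩ := Finite.exists_min fun i => D.F i a / D.F i b
  have h1 := D.le_prod_of_isMax hab (hκ i) hi
  have h2 : κ⁻¹ ≤ ∏ j ∈ Finset.univ.erase k, D.F j b / D.F j a := by
    refine D.le_prod_of_isMax hba ?_ fun j => ?_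
    · rw [hκ k, inv_mul_cancel_left₀ hκ0.ne']
    · rw [← inv_div, ← inv_div (D.F k a)]
      exact inv_anti₀ (hr k) (hk j)
  have h3 : ∏ j ∈ Finset.univ.erase k, D.F j b / D.F j a =
      (∏ j ∈ Finset.univ.erase k, D.F j a / D.F j b)⁻¹ := by
    rw [← Finset.prod_inv_distrib]
    exact Finset.prod_congr rfl fun j _ => (inv_div _ _).symm
  have hpos : 0 < ∏ j ∈ Finset.univ.erase k, D.F j a / D.F j b := Finset.prod_pos fun j _ => hr j
  rw [h3, inv_le_inv₀ hκ0 hpos] at h2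
  have e1 := Finset.mul_prod_erase Finset.univ (fun j => D.F j a / D.F j b) (Finset.mem_univ i)
  have e2 := Finset.mul_prod_erase Finset.univ (fun j => D.F j a / D.F j b) (Finset.mem_univ k)
  have hle : D.F i a / D.F i b ≤ D.F k a / D.F k b := by
    by_contra hlt
    have hlt : D.F k a / D.F k b < D.F i a / D.F i b := not_le.1 hlt
    have h4 := mul_lt_mul_of_pos_right hlt hpos
    have h5 := mul_le_mul_of_nonneg_left (h2.trans h1) (hr i).le
    linarith
  refine ⟨D.F k a / D.F k b, fun j => ?_⟩
  have : D.F j a / D.F j b = D.F k a / D.F k b := le_antisymm ((hi j).trans hle) (hk j)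
  rw [← this, div_mul_cancel₀ _ (D.F_pos j b hb).ne']

/-- Infinitesimal form of `le_prod_of_isMax`: the two evaluations are replaced by an evaluation
and a derivative at the same point. -/
theorem le_sum_of_isMax {a b : ℂ × ℂ} {κ : ℝ} {i : Fin 4}
    (hne : ∀ j, i ≠ j → symp a (D.v i j) ≠ 0) (ha : a ≠ 0)
    (hκ : ∑ j ∈ Finset.univ.erase i, 4 * (symp b (D.v i j) / symp a (D.v i j)).re = κ)
    (hi : ∀ j, (D.F j (a + b) - D.F j (a - b)) / D.F j a ≤
      (D.F i (a + b) - D.F i (a - b)) / D.F i a) :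
    κ ≤ ∑ j ∈ Finset.univ.erase i, (D.F j (a + b) - D.F j (a - b)) / D.F j a := by
  rw [← hκ]
  refine Finset.sum_le_sum fun j hj => ?_
  have hij : i ≠ j := (Finset.ne_of_mem_erase hj).symm
  have hA := Complex.normSq_pos.2 (hne j hij)
  have hpol := normSq_polarization (symp a (D.v i j)) (symp b (D.v i j)) (hne j hij)
  rw [← symp_add_left, ← symp_sub_left] at hpol
  have h1 := D.F_eq i j (a + b) hij
  have h2 := D.F_eq i j (a - b) hij
  have h3 := D.F_eq i j a hij
  have h4 := hi j
  have h5 := D.F_pos i a ha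
  have h6 := D.F_pos j a ha
  have h7 := D.lam_pos i j
  rw [div_le_div_iff₀ h6 h5] at h4
  rw [le_div_iff₀ h6]
  have e : Complex.normSq (symp a (D.v i j)) = D.F j a - D.lam i j * D.F i a := by linarith
  refine le_of_mul_le_mul_right ?_ hA
  have e2 : 4 * (symp b (D.v i j) / symp a (D.v i j)).re * D.F j a *
      Complex.normSq (symp a (D.v i j)) = (D.F j (a + b) - D.F j (a - b) -
        D.lam i j * (D.F i (a + b) - D.F i (a - b))) * D.F j a := by
    linear_combination (-D.F j a) * hpol - D.F j a * h1 + D.F j a * h2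
  rw [e2, e]
  nlinarith [mul_le_mul_of_nonneg_left h4 h7.le]

/-- Infinitesimal form of `exists_ratio_of_prod_eq`. -/
theorem exists_ratio_of_sum_eq {a b : ℂ × ℂ} (ha : a ≠ 0) {κ : ℝ}
    (hne : ∀ i j, i ≠ j → symp a (D.v i j) ≠ 0)
    (hκ : ∀ i, ∑ j ∈ Finset.univ.erase i, 4 * (symp b (D.v i j) / symp a (D.v i j)).re = κ) :
    ∃ g : ℝ, ∀ i, D.F i (a + b) - D.F i (a - b) = g * D.F i a := by
  obtain ⟨i, hi⟩ := Finite.exists_max fun i => (D.F i (a + b) - D.F i (a - b)) / D.F i a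
  obtain ⟨k, hk⟩ := Finite.exists_min fun i => (D.F i (a + b) - D.F i (a - b)) / D.F i a
  have h1 := D.le_sum_of_isMax (hne i) ha (hκ i) hi
  have hneg : ∀ j, (D.F j (a + -b) - D.F j (a - -b)) / D.F j a =
      -((D.F j (a + b) - D.F j (a - b)) / D.F j a) := fun j => by
    rw [sub_neg_eq_add, ← sub_eq_add_neg, ← neg_div, neg_sub]
  have h2 : -κ ≤ ∑ j ∈ Finset.univ.erase k, (D.F j (a + -b) - D.F j (a - -b)) / D.F j a := by
    refine D.le_sum_of_isMax (hne k) ha ?_ fun j => ?_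
    · rw [← hκ k, ← Finset.sum_neg_distrib]
      refine Finset.sum_congr rfl fun j _ => ?_
      rw [symp_neg_left, neg_div, Complex.neg_re]
      ring
    · rw [hneg, hneg]
      exact neg_le_neg (hk j)
  simp only [hneg, Finset.sum_neg_distrib, neg_le_neg_iff] at h2
  have e1 := Finset.add_sum_erase Finset.univ
    (fun j => (D.F j (a + b) - D.F j (a - b)) / D.F j a) (Finset.mem_univ i)
  have e2 := Finset.add_sum_erase Finset.univ
    (fun j => (D.F j (a + b) - D.F j (a - b)) / D.F j a) (Finset.mem_univ k)
  refine ⟨(D.F k (a + b) - D.F k (a - b)) / D.F k a, fun j => ?_⟩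
  have : (D.F j (a + b) - D.F j (a - b)) / D.F j a =
      (D.F k (a + b) - D.F k (a - b)) / D.F k a := by
    have := hi j
    have := hk j
    linarith
  rw [← this, div_mul_cancel₀ _ (D.F_pos j a ha).ne']

/-- If the forms of the four points are a basis of the Hermitian forms, no nonzero functional kills
the four cubics. -/
theorem eq_zero_of_functional_eq_zero
    (hind : ∀ c : Fin 4 → ℝ, (∀ z, ∑ i, c i * D.F i z = 0) → c = 0)
    (hspan : ∀ w, ∃ c : Fin 4 → ℝ, ∀ z, Complex.normSq (symp z w) = ∑ i, c i * D.F i z)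
    (q : Fin 4 → ℂ) (hq : ∀ i j k l : Fin 4, Finset.univ.erase i = {j, k, l} → j ≠ k → j ≠ l →
      k ≠ l → cubicFunctional q (D.v i j) (D.v i k) (D.v i l) = 0) : q = 0 := by
  obtain ⟨a, b, α, β, hab, hdec⟩ := exists_cubicFunctional_eq q
  obtain ⟨ha, hb⟩ := ne_zero_of_symp_ne_zero hab
  have hab2 : 0 < Complex.normSq (symp a b) := Complex.normSq_pos.2 hab
  by_contra hq0
  have hnz : ¬ (α = 0 ∧ β = 0) := by
    rintro ⟨rfl, rfl⟩
    refine hq0 (eq_zero_of_cubicFunctional_eq_zero fun u v w => ?_)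
    rcases hdec with h | h <;> simp [h]
  rcases hdec with hdec | hdec
  · have hprod : ∀ i, α * ∏ j ∈ Finset.univ.erase i, symp a (D.v i j) +
        β * ∏ j ∈ Finset.univ.erase i, symp b (D.v i j) = 0 := fun i => by
      obtain ⟨j, k, l, hij, hik, hil, hjk, hjl, hkl, he⟩ := exists_others i
      have := hq i j k l he hjk hjl hkl
      rw [hdec] at this
      rw [he, Finset.prod_insert (by simp [hjk, hjl]), Finset.prod_pair hkl,
        Finset.prod_insert (by simp [hjk, hjl]), Finset.prod_pair hkl]
      linear_combination this
    by_cases hα : α = 0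
    · obtain ⟨i, hi⟩ := D.exists_prod_symp_ne_zero hb
      have := hprod i
      rw [hα, zero_mul, zero_add] at this
      exact (mul_ne_zero (fun h => hnz ⟨hα, h⟩) hi) this
    by_cases hβ : β = 0
    · obtain ⟨i, hi⟩ := D.exists_prod_symp_ne_zero ha
      have := hprod i
      rw [hβ, zero_mul, add_zero] at this
      exact (mul_ne_zero hα hi) this
    obtain ⟨r, hr⟩ := D.exists_ratio_of_prod_eq (κ := Complex.normSq (β / α)) hab
      (Complex.normSq_pos.2 (div_ne_zero hβ hα)) fun i => by
        rw [← map_prod, ← map_prod, ← map_mul, ← Complex.normSq_neg]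
        congr 1
        have := hprod i
        field_simp
        linear_combination -this
    obtain ⟨c, hc⟩ := hspan b
    have h0 : Complex.normSq (symp a b) = r * Complex.normSq (symp b b) := by
      rw [hc, hc, Finset.mul_sum]
      refine Finset.sum_congr rfl fun i _ => ?_
      rw [hr]
      ring
    rw [symp_self, map_zero, mul_zero] at h0
    exact hab2.ne' h0
  · by_cases hβ : β = 0
    · obtain ⟨i, hi⟩ := D.exists_prod_symp_ne_zero ha
      obtain ⟨j, k, l, hij, hik, hil, hjk, hjl, hkl, he⟩ := exists_others i
      have := hq i j k l he hjk hjl hkl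
      rw [hdec, hβ, zero_mul, add_zero] at this
      rw [he, Finset.prod_insert (by simp [hjk, hjl]), Finset.prod_pair hkl, ← mul_assoc] at hi
      exact (mul_ne_zero (fun h => hnz ⟨h, hβ⟩) hi) this
    -- Two rays from one point cannot end at the same point.
    have hinj : ∀ i j k, i ≠ j → i ≠ k → j ≠ k → symp a (D.v i j) = 0 →
        symp a (D.v i k) ≠ 0 := fun i j k hij hik hjk h1 h2 => by
      obtain ⟨s, hs, hs'⟩ := exists_smul_of_symp_eq_zero ha (D.v_ne_zero i j hij) h1
      obtain ⟨t, ht, ht'⟩ := exists_smul_of_symp_eq_zero ha (D.v_ne_zero i k hik) h2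
      have := hind (fun m => if m = j then Complex.normSq t else if m = k then -Complex.normSq s
        else if m = i then Complex.normSq s * D.lam i k - Complex.normSq t * D.lam i j else 0)
        fun z => by
          have hsub : ({i, j, k} : Finset (Fin 4)) ⊆ Finset.univ := Finset.subset_univ _
          rw [← Finset.sum_subset hsub fun m _ hm => by
            simp only [Finset.mem_insert, Finset.mem_singleton, not_or] at hm
            simp [hm.1, hm.2.1, hm.2.2]]
          rw [Finset.sum_insert (by simp [hij, hik]), Finset.sum_pair hjk]
          simp only [hij, hik, hjk.symm, if_true, if_false]
          rw [D.F_eq i j z hij, D.F_eq i k z hik, hs', ht', symp_smul_right, symp_smul_right,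
            map_mul, map_mul]
          ring
      have h3 := congrFun this j
      simp only [if_true, Pi.zero_apply] at h3
      exact ht (Complex.normSq_eq_zero.1 h3)
    have hne3 : ∀ i j k l : Fin 4, i ≠ j → i ≠ k → i ≠ l → j ≠ k → j ≠ l → k ≠ l →
        symp a (D.v i j) ≠ 0 := fun i j k l hij hik hil hjk hjl hkl h => by
      have := hq i j k l (erase_eq_of_ne hij hik hil hjk hjl hkl) hjk hjl hkl
      rw [hdec, h] at this
      have h1 := symp_ne_zero_of_not_both (a := b) (by rwa [symp_swap, neg_ne_zero])
        (D.v_ne_zero i j hij) h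
      refine mul_ne_zero hβ (mul_ne_zero (mul_ne_zero h1 (hinj i j k hij hik hjk h))
        (hinj i j l hij hil hjl h)) ?_
      linear_combination this
    have hne : ∀ i j, i ≠ j → symp a (D.v i j) ≠ 0 := fun i j hij => by
      obtain ⟨k, l, h1, h2, h3, h4, h5⟩ : ∃ k l : Fin 4, i ≠ k ∧ i ≠ l ∧ j ≠ k ∧ j ≠ l ∧ k ≠ l := by
        revert i j
        decide
      exact hne3 i j k l hij h1 h2 h3 h4 h5
    obtain ⟨g, hg⟩ := D.exists_ratio_of_sum_eq (κ := 4 * (-(α / β)).re) (b := b) ha hne fun i => by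
      obtain ⟨j, k, l, hij, hik, hil, hjk, hjl, hkl, he⟩ := exists_others i
      have := hq i j k l he hjk hjl hkl
      rw [hdec] at this
      have n1 := hne i j hij
      have n2 := hne i k hik
      have n3 := hne i l hil
      rw [he, Finset.sum_insert (by simp [hjk, hjl]), Finset.sum_pair hkl, ← mul_add, ← mul_add,
        ← Complex.add_re, ← Complex.add_re]
      congr 2
      field_simp
      linear_combination this
    have hg' : ∀ w, Complex.normSq (symp (a + b) w) - Complex.normSq (symp (a - b) w) =
        g * Complex.normSq (symp a w) := fun w => by
      obtain ⟨c, hc⟩ := hspan w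
      rw [hc, hc, hc, Finset.mul_sum, ← Finset.sum_sub_distrib]
      refine Finset.sum_congr rfl fun i _ => ?_
      linear_combination c i * hg i
    -- Test on the two null vectors on which the left side takes opposite values.
    have h1 := hg' (a + b)
    have h2 := hg' (a - b)
    have e1 : symp a (a + b) = symp a b := by simp only [symp, Prod.fst_add, Prod.snd_add]; ring
    have e2 : symp a (a - b) = -symp a b := by simp only [symp, Prod.fst_sub, Prod.snd_sub]; ring
    have e3 : symp (a - b) (a + b) = 2 * symp a b := by
      simp only [symp, Prod.fst_add, Prod.snd_add, Prod.fst_sub, Prod.snd_sub]; ring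
    have e4 : symp (a + b) (a - b) = -(2 * symp a b) := by rw [symp_swap, e3]
    rw [symp_self, e1, e3] at h1
    rw [symp_self, e2, e4, Complex.normSq_neg, Complex.normSq_neg] at h2
    have h4 : Complex.normSq (2 * symp a b) ≠ 0 :=
      (Complex.normSq_pos.2 (mul_ne_zero two_ne_zero hab)).ne'
    apply h4
    rw [map_zero] at h1 h2
    linarith

end RayForms

/-! ### Ptolemy's theorem for null vectors -/

/-- Ptolemy's theorem: the hypotheses say that the end point `v` lies on the circle through
`r₁`, `r₂`, `r₃`, on the arc from `r₂` to `r₃` that does not contain `r₁`. -/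
theorem symp_ptolemy {v r₁ r₂ r₃ : ℂ × ℂ} {y₁ y₂ y₃ : ℝ}
    (hv : ∀ z, Complex.normSq (symp z v) = y₁ * Complex.normSq (symp z r₁) +
      y₂ * Complex.normSq (symp z r₂) + y₃ * Complex.normSq (symp z r₃))
    (h2 : 0 ≤ y₂) (h3 : 0 ≤ y₃) (h23 : 0 < y₂ + y₃) (h12 : symp r₁ r₂ ≠ 0) (h13 : symp r₁ r₃ ≠ 0) :
    ‖symp r₂ r₃‖ * ‖symp r₁ v‖ = ‖symp r₁ r₃‖ * ‖symp r₂ v‖ + ‖symp r₁ r₂‖ * ‖symp r₃ v‖ ∧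
      0 < ‖symp r₁ v‖ ∧
      ‖symp r₁ v‖ * ‖symp r₂ v‖ = y₃ * ‖symp r₂ r₃‖ * ‖symp r₁ r₃‖ ∧
      ‖symp r₁ v‖ * ‖symp r₃ v‖ = y₂ * ‖symp r₂ r₃‖ * ‖symp r₁ r₂‖ := by
  have e1 := hv r₁
  have e2 := hv r₂
  have e3 := hv r₃
  have e0 := hv v
  rw [normSq_symp_comm r₁ v, normSq_symp_comm r₂ v, normSq_symp_comm r₃ v] at e0
  rw [e1, e2, e3] at e0
  rw [normSq_symp_comm r₁ r₂] at e2 e0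
  rw [normSq_symp_comm r₁ r₃, normSq_symp_comm r₂ r₃] at e3 e0
  simp only [symp_self, map_zero, mul_zero, zero_add, add_zero, Complex.normSq_eq_norm_sq]
    at e0 e1 e2 e3
  have g2 : 0 < ‖symp r₁ r₃‖ := norm_pos_iff.2 h13
  have g3 : 0 < ‖symp r₁ r₂‖ := norm_pos_iff.2 h12
  have n1 := norm_nonneg (symp r₁ v)
  have n2 := norm_nonneg (symp r₂ v)
  have n3 := norm_nonneg (symp r₃ v)
  have g1 := norm_nonneg (symp r₂ r₃)
  generalize ‖symp r₁ v‖ = n₁ at *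
  generalize ‖symp r₂ v‖ = n₂ at *
  generalize ‖symp r₃ v‖ = n₃ at *
  generalize ‖symp r₂ r₃‖ = g₁ at *
  generalize ‖symp r₁ r₃‖ = g₂ at *
  generalize ‖symp r₁ r₂‖ = g₃ at *
  have hpos : 0 < n₁ := by
    have : 0 < n₁ ^ 2 := by
      rw [e1]
      rcases h2.lt_or_eq with h | h
      · have := mul_pos h (pow_pos g3 2)
        positivity
      · have := mul_pos (show 0 < y₃ by linarith) (pow_pos g2 2)
        positivity
    exact lt_of_le_of_ne n1 fun h => by simp [← h] at this
  have m2 : n₁ * n₂ = y₃ * g₁ * g₂ := by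
    refine (sq_eq_sq₀ (by positivity) (by positivity)).1 ?_
    rw [mul_pow, e1, e2]
    linear_combination -(1 / 2) * g₃ ^ 2 * e0
  have m3 : n₁ * n₃ = y₂ * g₁ * g₃ := by
    refine (sq_eq_sq₀ (by positivity) (by positivity)).1 ?_
    rw [mul_pow, e1, e3]
    linear_combination -(1 / 2) * g₂ ^ 2 * e0
  refine ⟨mul_left_cancel₀ hpos.ne' ?_, hpos, m2, m3⟩
  linear_combination g₁ * e1 - g₂ * m2 - g₃ * m3

/-- A form of rank one that is a combination of two independent forms of rank one is a multiple
of one of them. -/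
theorem mul_eq_zero_of_normSq_symp_eq {v a b : ℂ × ℂ} {p q : ℝ} (hab : symp a b ≠ 0)
    (hv : ∀ z, Complex.normSq (symp z v) =
      p * Complex.normSq (symp z a) + q * Complex.normSq (symp z b)) : p * q = 0 := by
  have e1 := hv a
  have e2 := hv b
  have e0 := hv v
  rw [normSq_symp_comm a v, normSq_symp_comm b v, e1, e2] at e0
  rw [normSq_symp_comm a b] at e0
  simp only [symp_self, map_zero, mul_zero, zero_add, add_zero] at e0
  have := (Complex.normSq_pos.2 hab).ne'
  have h : p * q * Complex.normSq (symp a b) = 0 := by linear_combination -(1 / 2) * e0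
  exact (mul_eq_zero.1 h).resolve_right this

/-- A strictly diagonally dominant system with three unknowns has only the zero solution. -/
theorem eq_zero_of_weighted_dominance {ci cj ck aii aij aik aji ajj ajk
    aki akj akk : ℝ} (hi : 0 ≤ ci) (hj : 0 ≤ cj) (hk : 0 ≤ ck) (di : aij + aik < aii)
    (dj : aji + ajk < ajj) (dk : aki + akj < akk) (ei : ci * aii ≤ cj * aji + ck * aki)
    (ej : cj * ajj ≤ ci * aij + ck * akj) (ek : ck * akk ≤ ci * aik + cj * ajk) :
    ci = 0 ∧ cj = 0 ∧ ck = 0 := by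
  have hi' := mul_nonneg hi (sub_pos.2 di).le
  have hj' := mul_nonneg hj (sub_pos.2 dj).le
  have hk' := mul_nonneg hk (sub_pos.2 dk).le
  refine ⟨?_, ?_, ?_⟩
  · exact (mul_eq_zero.1 (by linarith : ci * (aii - (aij + aik)) = 0)).resolve_right
      (sub_pos.2 di).ne'
  · exact (mul_eq_zero.1 (by linarith : cj * (ajj - (aji + ajk)) = 0)).resolve_right
      (sub_pos.2 dj).ne'
  · exact (mul_eq_zero.1 (by linarith : ck * (akk - (aki + akj)) = 0)).resolve_right
      (sub_pos.2 dk).ne'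

namespace RayForms

variable (D : RayForms)

/-! ### A point in the triangle spanned by the others -/

/-- Diagonal dominance: the cubic of the vertex `i` is large at the end point of the ray from `o`
to `i`, compared with its values at the end points of the rays to the other two vertices. -/
theorem dominance {o i j k : Fin 4} (hoi : o ≠ i) (hoj : o ≠ j) (hok : o ≠ k) (hij : i ≠ j)
    (hik : i ≠ k) {κi κj κk : ℝ} (hκj : 0 ≤ κj) (hκk : 0 ≤ κk)
    (hF : ∀ z, D.F o z = κi * Complex.normSq (symp z (D.v o i)) +
      κj * Complex.normSq (symp z (D.v o j)) + κk * Complex.normSq (symp z (D.v o k)))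
    (sij : symp (D.v o i) (D.v o j) ≠ 0) (sik : symp (D.v o i) (D.v o k) ≠ 0)
    (sjk : symp (D.v o j) (D.v o k) ≠ 0) :
    ‖symp (D.v o i) (D.v o k)‖ ^ 3 * (‖symp (D.v o j) (D.v i o)‖ * ‖symp (D.v o j) (D.v i j)‖ *
        ‖symp (D.v o j) (D.v i k)‖) +
      ‖symp (D.v o i) (D.v o j)‖ ^ 3 * (‖symp (D.v o k) (D.v i o)‖ * ‖symp (D.v o k) (D.v i j)‖ *
        ‖symp (D.v o k) (D.v i k)‖) <
    ‖symp (D.v o j) (D.v o k)‖ ^ 3 * (‖symp (D.v o i) (D.v i o)‖ * ‖symp (D.v o i) (D.v i j)‖ *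
        ‖symp (D.v o i) (D.v i k)‖) := by
  have hpos : 0 < κj + κk := by
    by_contra hle
    have h1 : κj = 0 := by linarith
    have h2 : κk = 0 := by linarith
    have h3 := D.F_pos o _ (D.v_ne_zero o i hoi)
    rw [hF, h1, h2, symp_self] at h3
    simp at h3
  -- The triangle inequality for the distances between `o`, `i` and `m`.
  have htri : ∀ m, o ≠ m → i ≠ m → 0 ≤ D.lam o m - D.lam i m * D.lam o i := fun m hom him => by
    have h1 := D.F_of_symp_eq_zero hom (symp_self (D.v o m))
    have h2 := D.F_eq o i (D.v o m) hoi
    have h3 := D.F_eq i m (D.v o m) him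
    have h4 := D.F_pos o _ (D.v_ne_zero o m hom)
    have h5 := D.lam_pos i m
    have h6 := Complex.normSq_nonneg (symp (D.v o m) (D.v i m))
    have h7 := mul_nonneg h5.le (Complex.normSq_nonneg (symp (D.v o m) (D.v o i)))
    by_contra hlt
    have h8 := mul_neg_of_neg_of_pos (not_le.1 hlt) h4
    rw [h2, h1] at h3
    nlinarith
  have tj := htri j hoj hij
  have tk := htri k hok hik
  have hl := D.lam_pos o i
  have hl1 := D.lam_lt_one o i hoi
  have hl2 : 0 < 1 - D.lam o i ^ 2 := by nlinarith
  obtain ⟨po, no, -, -⟩ := symp_ptolemy (v := D.v i o) (r₁ := D.v o i) (r₂ := D.v o j)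
    (r₃ := D.v o k) (y₁ := (1 - D.lam o i ^ 2) * κi - D.lam o i) (y₂ := (1 - D.lam o i ^ 2) * κj)
    (y₃ := (1 - D.lam o i ^ 2) * κk) (fun z => by
      have h1 := D.F_eq i o z hoi.symm
      rw [D.lam_symm i o, D.F_eq o i z hoi] at h1
      linear_combination -h1 + (1 - D.lam o i ^ 2) * hF z)
    (by positivity) (by positivity) (by rw [← mul_add]; positivity) sij sik
  obtain ⟨pj, nj, -, mj⟩ := symp_ptolemy (v := D.v i j) (r₁ := D.v o i) (r₂ := D.v o j)
    (r₃ := D.v o k) (y₁ := (D.lam o j - D.lam i j * D.lam o i) * κi - D.lam i j)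
    (y₂ := 1 + (D.lam o j - D.lam i j * D.lam o i) * κj)
    (y₃ := (D.lam o j - D.lam i j * D.lam o i) * κk) (fun z => by
      have h1 := D.F_eq i j z hij
      rw [D.F_eq o j z hoj, D.F_eq o i z hoi] at h1
      linear_combination -h1 + (D.lam o j - D.lam i j * D.lam o i) * hF z)
    (by positivity) (by positivity) (by positivity) sij sik
  obtain ⟨pk, nk, mk, -⟩ := symp_ptolemy (v := D.v i k) (r₁ := D.v o i) (r₂ := D.v o j)
    (r₃ := D.v o k) (y₁ := (D.lam o k - D.lam i k * D.lam o i) * κi - D.lam i k)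
    (y₂ := (D.lam o k - D.lam i k * D.lam o i) * κj)
    (y₃ := 1 + (D.lam o k - D.lam i k * D.lam o i) * κk) (fun z => by
      have h1 := D.F_eq i k z hik
      rw [D.F_eq o k z hok, D.F_eq o i z hoi] at h1
      linear_combination -h1 + (D.lam o k - D.lam i k * D.lam o i) * hF z)
    (by positivity) (by positivity) (by positivity) sij sik
  have g1 : 0 < ‖symp (D.v o j) (D.v o k)‖ := norm_pos_iff.2 sjk
  have g2 : 0 < ‖symp (D.v o i) (D.v o k)‖ := norm_pos_iff.2 sik
  have g3 : 0 < ‖symp (D.v o i) (D.v o j)‖ := norm_pos_iff.2 sij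
  have zj : 0 < ‖symp (D.v o k) (D.v i j)‖ :=
    pos_of_mul_pos_right (mj ▸ by positivity) nj.le
  have zk : 0 < ‖symp (D.v o j) (D.v i k)‖ :=
    pos_of_mul_pos_right (mk ▸ by positivity) nk.le
  have xo := mul_nonneg g2.le (norm_nonneg (symp (D.v o j) (D.v i o)))
  have yo := mul_nonneg g3.le (norm_nonneg (symp (D.v o k) (D.v i o)))
  have xj := mul_nonneg g2.le (norm_nonneg (symp (D.v o j) (D.v i j)))
  have yj := mul_pos g3 zj
  have xk := mul_pos g2 zk
  have yk := mul_nonneg g3.le (norm_nonneg (symp (D.v o k) (D.v i k)))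
  have so := mul_pos g1 no
  rw [po] at so
  have key : ∀ a b c a' b' c' : ℝ, 0 ≤ a → 0 ≤ a' → 0 ≤ b → 0 < b' → 0 < c → 0 ≤ c' →
      0 < a + a' → a * b * c + a' * b' * c' < (a + a') * (b + b') * (c + c') := by
    intro a b c a' b' c' ha ha' hb hb' hc hc' h
    have h1 : 0 < (a + a') * (b' * c) := by positivity
    have h2 : 0 ≤ a' * (b * c) + a * (b' * c') + (a + a') * (b * c') := by positivity
    linarith
  have := key _ _ _ _ _ _ xo yo xj yj xk yk so
  rw [← po, ← pj, ← pk] at this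
  linarith

theorem prod_erase_eq {o i j k : Fin 4} (hoi : o ≠ i) (hoj : o ≠ j) (hok : o ≠ k) (hij : i ≠ j)
    (hik : i ≠ k) (hjk : j ≠ k) (z : ℂ × ℂ) : ∏ m ∈ Finset.univ.erase o, symp z (D.v o m) =
      symp z (D.v o i) * symp z (D.v o j) * symp z (D.v o k) := by
  rw [erase_eq_of_ne hoi hoj hok hij hik hjk, Finset.prod_insert (by simp [hij, hik]),
    Finset.prod_pair hjk, mul_assoc]

/-- The cubics are independent if the end points of the three rays from the inner point `o` are
distinct. -/
theorem eq_zero_of_inner {o i j k : Fin 4} (hoi : o ≠ i) (hoj : o ≠ j) (hok : o ≠ k) (hij : i ≠ j)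
    (hik : i ≠ k) (hjk : j ≠ k) {κi κj κk : ℝ} (hκi : 0 ≤ κi) (hκj : 0 ≤ κj) (hκk : 0 ≤ κk)
    (hF : ∀ z, D.F o z = κi * Complex.normSq (symp z (D.v o i)) +
      κj * Complex.normSq (symp z (D.v o j)) + κk * Complex.normSq (symp z (D.v o k)))
    (sij : symp (D.v o i) (D.v o j) ≠ 0) (sik : symp (D.v o i) (D.v o k) ≠ 0)
    (sjk : symp (D.v o j) (D.v o k) ≠ 0) (c : Fin 4 → ℂ)
    (hc : ∀ z, ∑ l, c l * ∏ m ∈ Finset.univ.erase l, symp z (D.v l m) = 0) : c = 0 := by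
  have hsum : ∀ z, c i * (symp z (D.v i o) * symp z (D.v i j) * symp z (D.v i k)) +
      c j * (symp z (D.v j o) * symp z (D.v j i) * symp z (D.v j k)) +
      c k * (symp z (D.v k o) * symp z (D.v k i) * symp z (D.v k j)) =
      -(c o * (symp z (D.v o i) * symp z (D.v o j) * symp z (D.v o k))) := fun z => by
    have h1 := hc z
    have hsplit : (Finset.univ : Finset (Fin 4)) = {o, i, j, k} := by
      rw [← erase_eq_of_ne hoi hoj hok hij hik hjk, Finset.insert_erase (Finset.mem_univ o)]
    rw [Finset.sum_congr hsplit fun _ _ => rfl, Finset.sum_insert (by simp [hoi, hoj, hok]),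
      Finset.sum_insert (by simp [hij, hik]), Finset.sum_pair hjk,
      D.prod_erase_eq hoi hoj hok hij hik hjk,
      D.prod_erase_eq hoi.symm hij hik hoj hok hjk,
      D.prod_erase_eq hoj.symm hij.symm hjk hoi hok hik,
      D.prod_erase_eq hok.symm hik.symm hjk.symm hoi hoj hij] at h1
    linear_combination h1
  have tri : ∀ A B C : ℂ, A + B + C = 0 →
      ‖A‖ ≤ ‖B‖ + ‖C‖ ∧ ‖B‖ ≤ ‖A‖ + ‖C‖ ∧ ‖C‖ ≤ ‖A‖ + ‖B‖ := fun A B C h => by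
    refine ⟨?_, ?_, ?_⟩
    · rw [show A = -(B + C) by linear_combination h, norm_neg]
      exact norm_add_le B C
    · rw [show B = -(A + C) by linear_combination h, norm_neg]
      exact norm_add_le A C
    · rw [show C = -(A + B) by linear_combination h, norm_neg]
      exact norm_add_le A B
  have hi := hsum (D.v o i)
  have hj := hsum (D.v o j)
  have hk := hsum (D.v o k)
  rw [symp_self] at hi hj hk
  simp only [zero_mul, mul_zero, neg_zero] at hi hj hk
  have ti := (tri _ _ _ hi).1
  have tj := (tri _ _ _ hj).2.1
  have tk := (tri _ _ _ hk).2.2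
  simp only [norm_mul] at ti tj tk
  have di := D.dominance hoi hoj hok hij hik hκj hκk hF sij sik sjk
  have dj := D.dominance (κi := κj) hoj hoi hok hij.symm hjk hκi hκk (fun z => by rw [hF]; ring)
    (by rwa [symp_swap, neg_ne_zero]) sjk sik
  have dk := D.dominance (κi := κk) hok hoi hoj hik.symm hjk.symm hκi hκj (fun z => by rw [hF]; ring)
    (by rwa [symp_swap, neg_ne_zero]) (by rwa [symp_swap, neg_ne_zero]) sij
  rw [norm_symp_comm (D.v o i) (D.v o j)] at dj
  rw [norm_symp_comm (D.v o i) (D.v o k), norm_symp_comm (D.v o j) (D.v o k)] at dk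
  have g1 : 0 < ‖symp (D.v o j) (D.v o k)‖ := norm_pos_iff.2 sjk
  have g2 : 0 < ‖symp (D.v o i) (D.v o k)‖ := norm_pos_iff.2 sik
  have g3 : 0 < ‖symp (D.v o i) (D.v o j)‖ := norm_pos_iff.2 sij
  obtain ⟨z1, z2, z3⟩ := eq_zero_of_weighted_dominance (norm_nonneg (c i)) (norm_nonneg (c j))
    (norm_nonneg (c k)) di dj dk
    (by linarith [mul_le_mul_of_nonneg_left ti (pow_pos g1 3).le])
    (by linarith [mul_le_mul_of_nonneg_left tj (pow_pos g2 3).le])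
    (by linarith [mul_le_mul_of_nonneg_left tk (pow_pos g3 3).le])
  rw [norm_eq_zero] at z1 z2 z3
  obtain ⟨z, -, hz⟩ := exists_symp_ne_zero (Finset.univ.erase o) (D.v o)
    fun m hm => D.v_ne_zero o m (Finset.ne_of_mem_erase hm).symm
  have h0 := hsum z
  rw [z1, z2, z3, ← D.prod_erase_eq hoi hoj hok hij hik hjk] at h0
  have z0 : c o = 0 := by
    refine (mul_eq_zero.1 ?_).resolve_right (Finset.prod_ne_zero_iff.2 hz)
    linear_combination h0
  ext l
  have hl : l ∈ insert o (Finset.univ.erase o) := by simp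
  rw [erase_eq_of_ne hoi hoj hok hij hik hjk] at hl
  simp only [Finset.mem_insert, Finset.mem_singleton] at hl
  rcases hl with rfl | rfl | rfl | rfl <;> simp [*]

/-! ### Collinear points -/

/-- On a geodesic with end points `a` and `b` the cubics are, up to factors, the monomials in the
linear forms of `a` and `b`. -/
theorem eq_zero_of_collinear {a b : ℂ × ℂ} (hab : symp a b ≠ 0) {p q : Fin 4 → ℝ}
    (hF : ∀ i z, D.F i z = p i * Complex.normSq (symp z a) + q i * Complex.normSq (symp z b))
    (c : Fin 4 → ℂ) (hc : ∀ z, ∑ l, c l * ∏ m ∈ Finset.univ.erase l, symp z (D.v l m) = 0) :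
    c = 0 := by
  obtain ⟨ha, hb⟩ := ne_zero_of_symp_ne_zero hab
  have hg := Complex.normSq_pos.2 hab
  have hp : ∀ i, 0 < p i := fun i => by
    have h1 := D.F_pos i b hb
    rw [hF, symp_self, normSq_symp_comm a b, map_zero, mul_zero, add_zero] at h1
    exact pos_of_mul_pos_left h1 hg.le
  have hq : ∀ i, 0 < q i := fun i => by
    have h1 := D.F_pos i a ha
    rw [hF, symp_self, map_zero, mul_zero, zero_add] at h1
    exact pos_of_mul_pos_left h1 hg.le
  have hv : ∀ i j, i ≠ j → ∀ z, Complex.normSq (symp z (D.v i j)) =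
      (p j - D.lam i j * p i) * Complex.normSq (symp z a) +
        (q j - D.lam i j * q i) * Complex.normSq (symp z b) := fun i j hij z => by
    have h1 := D.F_eq i j z hij
    rw [hF, hF] at h1
    linear_combination -h1
  have hdich : ∀ i j, i ≠ j → (p j < p i ∧ ∃ s : ℂ, s ≠ 0 ∧ D.v i j = s • b) ∨
      (p i < p j ∧ ∃ s : ℂ, s ≠ 0 ∧ D.v i j = s • a) := fun i j hij => by
    have hl0 := D.lam_pos i j
    have hl1 := D.lam_lt_one i j hij
    rcases mul_eq_zero.1 (mul_eq_zero_of_normSq_symp_eq hab (hv i j hij)) with h | h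
    · refine Or.inl ⟨?_, exists_smul_of_symp_eq_zero hb (D.v_ne_zero i j hij) ?_⟩
      · nlinarith [hp i]
      · have := hv i j hij b
        rw [h, symp_self, map_zero, mul_zero, zero_mul, add_zero] at this
        exact Complex.normSq_eq_zero.1 this
    · refine Or.inr ⟨?_, exists_smul_of_symp_eq_zero ha (D.v_ne_zero i j hij) ?_⟩
      · have h' := mul_eq_zero.1 (mul_eq_zero_of_normSq_symp_eq hab (hv j i hij.symm))
        rw [D.lam_symm j i] at h'
        rcases h' with h' | h'
        · nlinarith [hp j]
        · exfalso
          have h2 : q i < q j := by nlinarith [hq j]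
          nlinarith [hq i]
      · have := hv i j hij a
        rw [h, symp_self, map_zero, mul_zero, zero_mul, add_zero] at this
        exact Complex.normSq_eq_zero.1 this
  have hs : ∀ i j, ∃ s : ℂ, i ≠ j → s ≠ 0 ∧ D.v i j = s • if p i < p j then a else b :=
    fun i j => by
      by_cases hij : i = j
      · exact ⟨0, fun h => absurd hij h⟩
      rcases hdich i j hij with ⟨h, s, hs, hsv⟩ | ⟨h, s, hs, hsv⟩
      · exact ⟨s, fun _ => ⟨hs, by rw [if_neg h.not_gt, hsv]⟩⟩
      · exact ⟨s, fun _ => ⟨hs, by rw [if_pos h, hsv]⟩⟩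
  choose s hs using hs
  let n : Fin 4 → ℕ := fun i => ((Finset.univ.erase i).filter fun j => p i < p j).card
  let k : Fin 4 → ℕ := fun i => ((Finset.univ.erase i).filter fun j => ¬ p i < p j).card
  have hn : Function.Injective n := by
    have hlt : ∀ i j, p i < p j → n j < n i := fun i j hij => by
      refine Finset.card_lt_card (Finset.ssubset_iff.2 ⟨j, by simp, fun l hl => ?_⟩)
      simp only [Finset.mem_insert, Finset.mem_filter, Finset.mem_erase, Finset.mem_univ,
        and_true] at hl ⊢
      rcases hl with rfl | ⟨-, hl⟩
      · exact ⟨fun h => by simp [h] at hij, hij⟩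
      · exact ⟨fun h => by rw [h] at hl; linarith, hij.trans hl⟩
    intro i j hij
    by_contra hne
    rcases hdich i j hne with ⟨h, -⟩ | ⟨h, -⟩
    · exact (hlt j i h).ne hij
    · exact (hlt i j h).ne' hij
  let S : Fin 4 → ℂ := fun i => ∏ j ∈ Finset.univ.erase i, s i j
  have hS : ∀ i, S i ≠ 0 := fun i => Finset.prod_ne_zero_iff.2 fun j hj =>
    (hs i j (Finset.ne_of_mem_erase hj).symm).1
  have hprod : ∀ i z, ∏ j ∈ Finset.univ.erase i, symp z (D.v i j) =
      S i * (symp z a ^ n i * symp z b ^ k i) := fun i z => by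
    rw [← Finset.prod_const, ← Finset.prod_const, ← Finset.prod_ite, ← Finset.prod_mul_distrib]
    refine Finset.prod_congr rfl fun j hj => ?_
    rw [(hs i j (Finset.ne_of_mem_erase hj).symm).2, symp_smul_right]
    split_ifs <;> rfl
  -- Restricting to the line `a + t b` turns the cubics into distinct powers of `t`.
  let f : ℂ[X] := ∑ i, monomial (n i) (c i * (S i * (symp b a ^ n i * symp a b ^ k i)))
  have hf : f = 0 := Polynomial.funext fun t => by
    rw [eval_zero, ← hc (a + t • b), eval_finsetSum]
    refine Finset.sum_congr rfl fun i _ => ?_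
    rw [hprod, eval_monomial, symp_add_left, symp_add_left, symp_smul_left, symp_smul_left,
      symp_self, symp_self, mul_zero, add_zero, zero_add, mul_pow]
    ring
  ext i
  have hcoef := congrArg (fun g => coeff g (n i)) hf
  simp only [f, finsetSum_coeff, coeff_monomial, coeff_zero, hn.eq_iff] at hcoef
  rw [Finset.sum_ite_eq' Finset.univ i, if_pos (Finset.mem_univ i)] at hcoef
  refine (mul_eq_zero.1 hcoef).resolve_right (mul_ne_zero (hS i) (mul_ne_zero (pow_ne_zero _ ?_)
    (pow_ne_zero _ hab)))
  rwa [symp_swap, neg_ne_zero]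

/-- If two rays from the inner point `o` have the same end point, all four points lie on one
geodesic. -/
theorem exists_collinear {o i j k : Fin 4} (hoi : o ≠ i) (hoj : o ≠ j) (hok : o ≠ k) (hij : i ≠ j)
    (hik : i ≠ k) (hjk : j ≠ k) {mi mj mk : ℝ}
    (hm : ∀ z, D.F o z = mi * D.F i z + mj * D.F j z + mk * D.F k z)
    (hlt : mi * D.lam o i + mj * D.lam o j + mk * D.lam o k < 1)
    (h : symp (D.v o i) (D.v o j) = 0) :
    ∃ a b, symp a b ≠ 0 ∧ ∃ p q : Fin 4 → ℝ, ∀ l z,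
      D.F l z = p l * Complex.normSq (symp z a) + q l * Complex.normSq (symp z b) := by
  have ha := D.v_ne_zero o i hoi
  have hFa := D.F_pos o _ ha
  have hi : ∀ z, D.F i z = D.lam o i * D.F o z + Complex.normSq (symp z (D.v o i)) :=
    fun z => D.F_eq o i z hoi
  have ho : ∀ z, D.F o z = D.lam o i * D.F i z + Complex.normSq (symp z (D.v i o)) := fun z => by
    rw [D.lam_symm]
    exact D.F_eq i o z hoi.symm
  have hl0 := D.lam_pos o i
  have hl1 := D.lam_lt_one o i hoi
  have hl2 : 1 - D.lam o i ^ 2 ≠ 0 := by nlinarith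
  obtain ⟨s, -, hs⟩ := exists_smul_of_symp_eq_zero ha (D.v_ne_zero o j hoj) h
  have hj : ∀ z, D.F j z = D.lam o j * D.F o z +
      Complex.normSq s * Complex.normSq (symp z (D.v o i)) := fun z => by
    rw [D.F_eq o j z hoj, hs, symp_smul_right, map_mul]
  have hmk : mk ≠ 0 := by
    rintro rfl
    have h1 := hm (D.v o i)
    rw [hi, hj, symp_self, map_zero, mul_zero, add_zero, add_zero] at h1
    have h2 := mul_lt_mul_of_pos_right hlt hFa
    linarith
  have hab : symp (D.v o i) (D.v i o) ≠ 0 := fun h0 => by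
    have h1 := ho (D.v o i)
    rw [hi, h0, symp_self, map_zero, add_zero, add_zero] at h1
    have : (1 - D.lam o i ^ 2) * D.F o (D.v o i) = 0 := by linear_combination h1
    exact (mul_ne_zero hl2 hFa.ne') this
  refine ⟨D.v o i, D.v i o, hab, ?_⟩
  suffices hex : ∀ l, ∃ p q : ℝ, ∀ z, D.F l z = p * Complex.normSq (symp z (D.v o i)) +
      q * Complex.normSq (symp z (D.v i o)) by
    choose p q hpq using hex
    exact ⟨p, q, hpq⟩
  have eo : ∃ p q : ℝ, ∀ z, D.F o z = p * Complex.normSq (symp z (D.v o i)) +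
      q * Complex.normSq (symp z (D.v i o)) := by
    refine ⟨D.lam o i / (1 - D.lam o i ^ 2), 1 / (1 - D.lam o i ^ 2), fun z => ?_⟩
    field_simp
    linear_combination ho z + D.lam o i * hi z
  obtain ⟨p, q, hpq⟩ := eo
  have ei : ∀ z, D.F i z = (D.lam o i * p + 1) * Complex.normSq (symp z (D.v o i)) +
      (D.lam o i * q) * Complex.normSq (symp z (D.v i o)) := fun z => by
    rw [hi, hpq]
    ring
  have ej : ∀ z, D.F j z = (D.lam o j * p + Complex.normSq s) *
      Complex.normSq (symp z (D.v o i)) +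
      (D.lam o j * q) * Complex.normSq (symp z (D.v i o)) := fun z => by
    rw [hj, hpq]
    ring
  intro l
  have hl : l ∈ insert o (Finset.univ.erase o) := by simp
  rw [erase_eq_of_ne hoi hoj hok hij hik hjk] at hl
  simp only [Finset.mem_insert, Finset.mem_singleton] at hl
  rcases hl with rfl | rfl | rfl | rfl
  · exact ⟨p, q, hpq⟩
  · exact ⟨_, _, ei⟩
  · exact ⟨_, _, ej⟩
  · refine ⟨(p - mi * (D.lam o i * p + 1) - mj * (D.lam o j * p + Complex.normSq s)) / mk,
      (q - mi * (D.lam o i * q) - mj * (D.lam o j * q)) / mk, fun z => ?_⟩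
    have h1 := hm z
    rw [ei, ej, hpq] at h1
    field_simp
    linear_combination -h1

/-- The cubics are independent if one of the points is a nonnegative combination of the others. -/
theorem eq_zero_of_mem_hull {o : Fin 4} {m : Fin 4 → ℝ} (hm0 : ∀ i, 0 ≤ m i)
    (hm : ∀ z, D.F o z = ∑ i ∈ Finset.univ.erase o, m i * D.F i z) (c : Fin 4 → ℂ)
    (hc : ∀ z, ∑ l, c l * ∏ m ∈ Finset.univ.erase l, symp z (D.v l m) = 0) : c = 0 := by
  obtain ⟨i, j, k, hoi, hoj, hok, hij, hik, hjk, he⟩ := exists_others o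
  have hm' : ∀ z, D.F o z = m i * D.F i z + m j * D.F j z + m k * D.F k z := fun z => by
    rw [hm, he, Finset.sum_insert (by simp [hij, hik]), Finset.sum_pair hjk, add_assoc]
  have hrank : ∀ z, (1 - (m i * D.lam o i + m j * D.lam o j + m k * D.lam o k)) * D.F o z =
      m i * Complex.normSq (symp z (D.v o i)) + m j * Complex.normSq (symp z (D.v o j)) +
        m k * Complex.normSq (symp z (D.v o k)) := fun z => by
    have h1 := hm' z
    rw [D.F_eq o i z hoi, D.F_eq o j z hoj, D.F_eq o k z hok] at h1
    linear_combination h1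
  have hlt : m i * D.lam o i + m j * D.lam o j + m k * D.lam o k < 1 := by
    obtain ⟨z, hz0, hz⟩ := exists_symp_ne_zero (Finset.univ.erase o) (D.v o)
      fun m hm => D.v_ne_zero o m (Finset.ne_of_mem_erase hm).symm
    have hFz := D.F_pos o z hz0
    have pi := Complex.normSq_pos.2 (hz i (by simp [hoi.symm]))
    have pj := Complex.normSq_pos.2 (hz j (by simp [hoj.symm]))
    have pk := Complex.normSq_pos.2 (hz k (by simp [hok.symm]))
    have hi := mul_nonneg (hm0 i) pi.le
    have hj := mul_nonneg (hm0 j) pj.le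
    have hk := mul_nonneg (hm0 k) pk.le
    have hr := hrank z
    by_contra hge
    have hle : (1 - (m i * D.lam o i + m j * D.lam o j + m k * D.lam o k)) * D.F o z ≤ 0 :=
      mul_nonpos_of_nonpos_of_nonneg (by linarith [not_lt.1 hge]) hFz.le
    have ei : m i = 0 := (mul_eq_zero.1 (by linarith)).resolve_right pi.ne'
    have ej : m j = 0 := (mul_eq_zero.1 (by linarith)).resolve_right pj.ne'
    have ek : m k = 0 := (mul_eq_zero.1 (by linarith)).resolve_right pk.ne'
    have := hm' z
    rw [ei, ej, ek] at this
    linarith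
  by_cases sij : symp (D.v o i) (D.v o j) = 0
  · obtain ⟨a, b, hab, p, q, hpq⟩ := D.exists_collinear hoi hoj hok hij hik hjk hm' hlt sij
    exact D.eq_zero_of_collinear hab hpq c hc
  by_cases sik : symp (D.v o i) (D.v o k) = 0
  · obtain ⟨a, b, hab, p, q, hpq⟩ := D.exists_collinear hoi hok hoj hik hij hjk.symm
      (mi := m i) (mj := m k) (mk := m j) (fun z => by rw [hm']; ring) (by linarith) sik
    exact D.eq_zero_of_collinear hab hpq c hc
  by_cases sjk : symp (D.v o j) (D.v o k) = 0
  · obtain ⟨a, b, hab, p, q, hpq⟩ := D.exists_collinear hoj hok hoi hjk hij.symm hik.symm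
      (mi := m j) (mj := m k) (mk := m i) (fun z => by rw [hm']; ring) (by linarith) sjk
    exact D.eq_zero_of_collinear hab hpq c hc
  have hpos := sub_pos.2 hlt
  refine D.eq_zero_of_inner hoi hoj hok hij hik hjk (div_nonneg (hm0 i) hpos.le)
    (div_nonneg (hm0 j) hpos.le) (div_nonneg (hm0 k) hpos.le) (fun z => ?_) sij sik sjk c hc
  have := hrank z
  field_simp
  linear_combination this

end RayForms

/-! ### Minkowski space as the space of Hermitian forms -/

/-- The value at `z` of the Hermitian form on `ℂ²` that corresponds to a vector of Minkowski
space, as a linear functional of that vector. -/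
noncomputable def hform (z : ℂ × ℂ) : Minkowski →ₗ[ℝ] ℝ where
  toFun X := Complex.normSq z.1 * (X.1 - X.2 2) + Complex.normSq z.2 * (X.1 + X.2 2) -
    2 * ((z.1 * (starRingEnd ℂ) z.2).re * X.2 0 + (z.1 * (starRingEnd ℂ) z.2).im * X.2 1)
  map_add' X Y := by
    simp only [Prod.fst_add, Prod.snd_add, PiLp.add_apply]
    ring
  map_smul' c X := by
    simp only [Prod.smul_fst, Prod.smul_snd, PiLp.smul_apply, smul_eq_mul, RingHom.id_apply]
    ring

theorem hform_apply (z : ℂ × ℂ) (X : Minkowski) : hform z X =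
    Complex.normSq z.1 * (X.1 - X.2 2) + Complex.normSq z.2 * (X.1 + X.2 2) -
    2 * ((z.1 * (starRingEnd ℂ) z.2).re * X.2 0 + (z.1 * (starRingEnd ℂ) z.2).im * X.2 1) := rfl

theorem eq_zero_of_hform_eq_zero {X : Minkowski} (h : ∀ z, hform z X = 0) : X = 0 := by
  have h1 := h (1, 0)
  have h2 := h (0, 1)
  have h3 := h (1, 1)
  have h4 := h (1, Complex.I)
  simp [hform_apply] at h1 h2 h3 h4
  refine Prod.ext (by simp; linarith) ?_
  ext i
  fin_cases i <;> simp <;> linarith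

/-- Every Hermitian form of rank one comes from Minkowski space. -/
theorem exists_hform_eq_normSq_symp (w : ℂ × ℂ) :
    ∃ X : Minkowski, ∀ z, hform z X = Complex.normSq (symp z w) := by
  refine ⟨((Complex.normSq w.1 + Complex.normSq w.2) / 2,
    !₂[(w.1 * (starRingEnd ℂ) w.2).re, (w.1 * (starRingEnd ℂ) w.2).im,
      (Complex.normSq w.1 - Complex.normSq w.2) / 2]), fun z => ?_⟩
  simp [hform_apply, symp, Complex.normSq_apply]
  ring

theorem hform_lift_pos (x : H3) {z : ℂ × ℂ} (hz : z ≠ 0) : 0 < hform z (lift x) := by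
  have h1 := lift_sq x
  have h2 := norm_liftV_lt x
  rw [real_inner_self_eq_norm_sq, EuclideanSpace.norm_sq_eq, Fin.sum_univ_three] at h1
  simp only [Real.norm_eq_abs, sq_abs] at h1
  have h3 := (PiLp.norm_apply_le (liftV x) 2).trans_lt h2
  rw [Real.norm_eq_abs] at h3
  have hA : 0 < liftT x - liftV x 2 := by linarith [le_abs_self (liftV x 2)]
  -- Complete the square.
  have key : (liftT x - liftV x 2) * hform z (lift x) =
      Complex.normSq (((liftT x - liftV x 2 : ℝ) : ℂ) * z.1 -
        (⟨liftV x 0, liftV x 1⟩ : ℂ) * z.2) + Complex.normSq z.2 := by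
    simp only [hform_apply, lift, Complex.normSq_apply, Complex.sub_re, Complex.sub_im,
      Complex.mul_re, Complex.mul_im, Complex.ofReal_re, Complex.ofReal_im, Complex.conj_re,
      Complex.conj_im]
    linear_combination (z.2.re ^ 2 + z.2.im ^ 2) * h1
  have hpos : 0 < (liftT x - liftV x 2) * hform z (lift x) := by
    rw [key]
    by_cases h : z.2 = 0
    · have h' : z.1 ≠ 0 := fun h' => hz (Prod.ext h' h)
      have : 0 < Complex.normSq (((liftT x - liftV x 2 : ℝ) : ℂ) * z.1) :=
        Complex.normSq_pos.2 (mul_ne_zero (Complex.ofReal_ne_zero.2 hA.ne') h')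
      simpa [h] using this
    · have := Complex.normSq_pos.2 h
      have := Complex.normSq_nonneg (((liftT x - liftV x 2 : ℝ) : ℂ) * z.1 -
        (⟨liftV x 0, liftV x 1⟩ : ℂ) * z.2)
      linarith
  exact pos_of_mul_pos_right hpos hA.le

/-- The homogeneous linear factor with root `v.1 / v.2`. -/
noncomputable def vecFactor (v : ℂ × ℂ) : ℂ[X] := C v.2 * X - C v.1

theorem vecFactor_smul (s : ℂ) (v : ℂ × ℂ) : vecFactor (s • v) = C s * vecFactor v := by
  simp only [vecFactor, Prod.smul_fst, Prod.smul_snd, smul_eq_mul, C_mul]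
  ring

/-- A point of the sphere at infinity is represented by a vector of `ℂ²` whose ratio of
coordinates is its stereographic projection and whose rank one form is its null vector. -/
theorem exists_vec_of_sphere (ξ : SphereAtInfinity) : ∃ v : ℂ × ℂ, v ≠ 0 ∧
    (∀ z, hform z (1, ξ.1) = Complex.normSq (symp z v)) ∧
    ∃ γ : ℂ, γ ≠ 0 ∧ linearFactor (toRiemannSphere ξ) = C γ * vecFactor v := by
  have hn : ξ.1 0 ^ 2 + ξ.1 1 ^ 2 + ξ.1 2 ^ 2 = 1 := by
    have := EuclideanSpace.norm_sq_eq ξ.1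
    rw [mem_sphere_zero_iff_norm.1 ξ.2, Fin.sum_univ_three] at this
    simp only [Real.norm_eq_abs, sq_abs] at this
    linarith
  by_cases h : ξ.1 2 = 1
  · have h0 : ξ.1 0 = 0 := by nlinarith
    have h1 : ξ.1 1 = 0 := by nlinarith
    have hs : ((√2 : ℝ) : ℂ) ≠ 0 := Complex.ofReal_ne_zero.2 (by positivity)
    refine ⟨(((√2 : ℝ) : ℂ), 0), fun h => hs (congrArg Prod.fst h), fun z => ?_,
      -(((√2 : ℝ) : ℂ))⁻¹, neg_ne_zero.2 (inv_ne_zero hs), ?_⟩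
    · have e : symp z (((√2 : ℝ) : ℂ), 0) = -(z.2 * ((√2 : ℝ) : ℂ)) := by simp [symp]
      rw [e, Complex.normSq_neg, map_mul, Complex.normSq_ofReal, Real.mul_self_sqrt two_pos.le]
      simp only [hform_apply, h, h0, h1]
      ring
    · rw [toRiemannSphere, if_pos h]
      change (1 : ℂ[X]) = _
      rw [vecFactor, C_0, zero_mul, zero_sub, C_neg, neg_mul_neg, ← C_mul, inv_mul_cancel₀ hs, C_1]
  · have hlt : 0 < 1 - ξ.1 2 := by
      rcases lt_or_gt_of_ne h with h' | h'
      · linarith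
      · nlinarith [sq_nonneg (ξ.1 0), sq_nonneg (ξ.1 1)]
    have hc : (1 - (ξ.1 2 : ℂ)) ≠ 0 := by
      rw [← Complex.ofReal_one, ← Complex.ofReal_sub]
      exact Complex.ofReal_ne_zero.2 hlt.ne'
    have hs : ((√(1 - ξ.1 2) : ℝ) : ℂ) ≠ 0 := Complex.ofReal_ne_zero.2 (by positivity)
    refine ⟨((√(1 - ξ.1 2) : ℝ) : ℂ) •
      (((ξ.1 0 : ℂ) + (ξ.1 1 : ℂ) * Complex.I) / (1 - (ξ.1 2 : ℂ)), 1),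
      fun h => hs (by simpa using congrArg Prod.snd h), fun z => ?_,
      (((√(1 - ξ.1 2) : ℝ) : ℂ))⁻¹, inv_ne_zero hs, ?_⟩
    · rw [symp_smul_right, map_mul, Complex.normSq_ofReal, Real.mul_self_sqrt hlt.le]
      have e : symp z (((ξ.1 0 : ℂ) + (ξ.1 1 : ℂ) * Complex.I) / (1 - (ξ.1 2 : ℂ)), 1) =
          (((1 - ξ.1 2 : ℝ) : ℂ) * z.1 - (⟨ξ.1 0, ξ.1 1⟩ : ℂ) * z.2) / ((1 - ξ.1 2 : ℝ) : ℂ) := by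
        rw [Complex.mk_eq_add_mul_I]
        simp only [symp, Complex.ofReal_sub, Complex.ofReal_one]
        field_simp
      rw [e, Complex.normSq_div, Complex.normSq_ofReal]
      field_simp
      simp only [hform_apply, Complex.normSq_apply, Complex.sub_re, Complex.sub_im,
        Complex.mul_re, Complex.mul_im, Complex.ofReal_re, Complex.ofReal_im, Complex.conj_re,
        Complex.conj_im]
      linear_combination (-z.2.re ^ 2 - z.2.im ^ 2) * hn
    · rw [vecFactor_smul, ← mul_assoc, ← C_mul, inv_mul_cancel₀ hs, C_1, one_mul, toRiemannSphere,
        if_neg h, vecFactor, C_1, one_mul]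
      rfl

/-- The ray relation in terms of Hermitian forms. -/
theorem exists_vec_of_ray {x y : H3} (h : x ≠ y) : ∃ v : ℂ × ℂ, v ≠ 0 ∧
    (∀ z, hform z (lift y) =
      Real.exp (-hdist x y) * hform z (lift x) + Complex.normSq (symp z v)) ∧
    ∃ γ : ℂ, γ ≠ 0 ∧ linearFactor (toRiemannSphere (rayLimit h)) = C γ * vecFactor v := by
  obtain ⟨s, hs, hlim⟩ := (exists_isRayLimit h).choose_spec.exists_smul h
  obtain ⟨v, hv, hform_v, γ, hγ, hfac⟩ := exists_vec_of_sphere (rayLimit h)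
  have hs' : ((√s : ℝ) : ℂ) ≠ 0 := Complex.ofReal_ne_zero.2 (by positivity)
  refine ⟨((√s : ℝ) : ℂ) • v, smul_ne_zero hs' hv, fun z => ?_, γ * (((√s : ℝ) : ℂ))⁻¹,
    mul_ne_zero hγ (inv_ne_zero hs'), ?_⟩
  · rw [symp_smul_right, map_mul, Complex.normSq_ofReal, Real.mul_self_sqrt hs.le, ← hform_v]
    have := congrArg (hform z) hlim
    rw [map_sub, map_smul, map_smul, smul_eq_mul, smul_eq_mul] at this
    change _ = s * hform z (1, (rayLimit h).1) at this
    linarith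
  · rw [vecFactor_smul, hfac, ← mul_assoc, ← C_mul, inv_mul_cancel_right₀ hs']

/-- The Hermitian forms and end point vectors of a configuration of four points. -/
theorem exists_rayForms (x : Configuration 4) : ∃ D : RayForms,
    (∀ i z, D.F i z = hform z (lift (x i))) ∧
    ∀ i j (h : i ≠ j), ∃ γ : ℂ, γ ≠ 0 ∧ linearFactor (x.root h) = C γ * vecFactor (D.v i j) := by
  have hex : ∀ i j, ∃ v : ℂ × ℂ, ∀ h : i ≠ j, v ≠ 0 ∧
      (∀ z, hform z (lift (x j)) = Real.exp (-hdist (x i) (x j)) * hform z (lift (x i)) +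
        Complex.normSq (symp z v)) ∧
      ∃ γ : ℂ, γ ≠ 0 ∧ linearFactor (x.root h) = C γ * vecFactor v := fun i j => by
    by_cases h : i = j
    · exact ⟨0, fun h' => absurd h h'⟩
    · obtain ⟨v, hv⟩ := exists_vec_of_ray (x.injective.ne h)
      exact ⟨v, fun _ => hv⟩
  choose v hv using hex
  refine ⟨⟨fun i z => hform z (lift (x i)), fun i j => Real.exp (-hdist (x i) (x j)), v,
    fun i z hz => hform_lift_pos (x i) hz, fun i j => Real.exp_pos _, fun i j h => ?_,
    fun i j => by simp only [hdist_comm], fun i j h => (hv i j h).1,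
    fun i j z h => (hv i j h).2.1 z⟩, fun i z => rfl, fun i j h => (hv i j h).2.2⟩
  have := hdist_pos (x.injective.ne h)
  exact Real.exp_lt_one_iff.2 (by linarith)

/-! ### From cubics to their coefficients -/

theorem sum_mul_coeff_vecFactor (q : Fin 4 → ℂ) (u v w : ℂ × ℂ) :
    ∑ k : Fin 4, q k * (vecFactor u * (vecFactor v * vecFactor w)).coeff k =
      cubicFunctional q u v w := by
  have e : vecFactor u * (vecFactor v * vecFactor w) =
      C (u.2 * v.2 * w.2) * X ^ 3 +
        C (-(u.2 * v.2 * w.1 + u.2 * v.1 * w.2 + u.1 * v.2 * w.2)) * X ^ 2 +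
        C (u.2 * v.1 * w.1 + u.1 * v.2 * w.1 + u.1 * v.1 * w.2) * X + C (-(u.1 * v.1 * w.1)) := by
    simp only [vecFactor, C_mul, C_add, C_neg]
    ring
  have hcoeff : ∀ a b c d : ℂ,
      ∑ k : Fin 4, q k * (C a * X ^ 3 + C b * X ^ 2 + C c * X + C d).coeff k =
        q 0 * d + q 1 * c + q 2 * b + q 3 * a := fun a b c d => by
    rw [Fin.sum_univ_four]
    simp [coeff_X, coeff_C, coeff_X_pow]
  rw [e, hcoeff, cubicFunctional]
  ring

/-- The matrix of coefficients of the cubics with the roots represented by `v i j`, `j ≠ i`. -/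
noncomputable def coeffMatrix (v : Fin 4 → Fin 4 → ℂ × ℂ) : Matrix (Fin 4) (Fin 4) ℂ :=
  Matrix.of fun i k => (∏ j ∈ Finset.univ.erase i, vecFactor (v i j)).coeff k

theorem coeffMatrix_mulVec (v : Fin 4 → Fin 4 → ℂ × ℂ) (q : Fin 4 → ℂ) {i j k l : Fin 4}
    (he : Finset.univ.erase i = {j, k, l}) (hjk : j ≠ k) (hjl : j ≠ l) (hkl : k ≠ l) :
    (coeffMatrix v).mulVec q i = cubicFunctional q (v i j) (v i k) (v i l) := by
  rw [← sum_mul_coeff_vecFactor, Matrix.mulVec, dotProduct]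
  refine Finset.sum_congr rfl fun m _ => ?_
  rw [coeffMatrix, Matrix.of_apply, he, Finset.prod_insert (by simp [hjk, hjl]),
    Finset.prod_pair hkl, mul_comm]

/-- The moment vector of `z` is the functional of homogeneous evaluation at `z`. -/
theorem coeffMatrix_mulVec_moment (v : Fin 4 → Fin 4 → ℂ × ℂ) (z : ℂ × ℂ) (i : Fin 4) :
    (coeffMatrix v).mulVec ![z.2 ^ 3, z.1 * z.2 ^ 2, z.1 ^ 2 * z.2, z.1 ^ 3] i =
      ∏ j ∈ Finset.univ.erase i, symp z (v i j) := by
  obtain ⟨j, k, l, hij, hik, hil, hjk, hjl, hkl, he⟩ := exists_others i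
  rw [coeffMatrix_mulVec v _ he hjk hjl hkl, he, Finset.prod_insert (by simp [hjk, hjl]),
    Finset.prod_pair hkl]
  simp [cubicFunctional, symp]
  ring

theorem ahc_of_det_ne_zero (x : Configuration 4) {v : Fin 4 → Fin 4 → ℂ × ℂ}
    (hv : ∀ i j (h : i ≠ j), ∃ γ : ℂ, γ ≠ 0 ∧ linearFactor (x.root h) = C γ * vecFactor (v i j))
    (hdet : (coeffMatrix v).det ≠ 0) : x.AHC := by
  intro p hp
  have hp' : ∀ i, ∃ c : ℂ, c ≠ 0 ∧
      p i = C c * ∏ j ∈ Finset.univ.erase i, vecFactor (v i j) := fun i => by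
    obtain ⟨c, hc, hpi⟩ := hp i
    choose γ hγ hfac using fun j : {j : Fin 4 // i ≠ j} => hv i j.1 j.2
    refine ⟨c * ∏ j, γ j, mul_ne_zero hc (Finset.prod_ne_zero_iff.2 fun j _ => hγ j), ?_⟩
    rw [hpi, Finset.prod_subtype (Finset.univ.erase i) (p := fun j => i ≠ j)
      (fun j => by simp [eq_comm]), Finset.prod_congr rfl fun j _ => hfac j,
      Finset.prod_mul_distrib, C_mul, map_prod, mul_assoc]
  choose c hc hpc using hp'
  refine Fintype.linearIndependent_iff.2 fun g hg => ?_
  have hzero : Matrix.vecMul (fun i => g i * c i) (coeffMatrix v) = 0 := by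
    ext k
    have := congrArg (fun f => coeff f (k : ℕ)) hg
    simp only [finsetSum_coeff, coeff_smul, smul_eq_mul, coeff_zero] at this
    rw [Pi.zero_apply, ← this, Matrix.vecMul, dotProduct]
    refine Finset.sum_congr rfl fun i _ => ?_
    rw [hpc, coeff_C_mul, coeffMatrix, Matrix.of_apply, mul_assoc]
  intro i
  have := congrFun (Matrix.eq_zero_of_vecMul_eq_zero hdet hzero) i
  exact (mul_eq_zero.1 this).resolve_right (hc i)

/-! ### The two cases -/

theorem ahc_of_not_coplanar (x : Configuration 4) (h : ¬ x.Coplanar) : x.AHC := by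
  obtain ⟨D, hF, hv⟩ := exists_rayForms x
  have hli := linearIndependent_lift_of_not_coplanar x h
  refine ahc_of_det_ne_zero x hv fun hdet => ?_
  obtain ⟨q, hq0, hq⟩ := Matrix.exists_mulVec_eq_zero_iff.2 hdet
  have hsum : ∀ (c : Fin 4 → ℝ) z, ∑ i, c i * D.F i z = hform z (∑ i, c i • lift (x i)) :=
    fun c z => by simp only [hF, map_sum, map_smul, smul_eq_mul]
  refine hq0 (D.eq_zero_of_functional_eq_zero (fun c hc => ?_) (fun w => ?_) q
    fun i j k l he hjk hjl hkl => ?_)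
  · simp only [hsum] at hc
    exact funext (Fintype.linearIndependent_iff.1 hli c (eq_zero_of_hform_eq_zero hc))
  · obtain ⟨X, hX⟩ := exists_hform_eq_normSq_symp w
    have hX' : X ∈ Submodule.span ℝ (Set.range fun i => lift (x i)) := by
      rw [hli.span_eq_top_of_card_eq_finrank (by simp [Minkowski, E3])]
      trivial
    obtain ⟨c, rfl⟩ := (Submodule.mem_span_range_iff_exists_fun ℝ).1 hX'
    exact ⟨c, fun z => by rw [← hX, hsum]⟩
  · rw [← coeffMatrix_mulVec D.v q he hjk hjl hkl, hq, Pi.zero_apply]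

theorem ahc_of_mem_hconvexHull (x : Configuration 4) {o : Fin 4}
    (ho : x o ∈ hconvexHull (x '' {j | j ≠ o})) : x.AHC := by
  obtain ⟨D, hF, hv⟩ := exists_rayForms x
  have hset : {j : Fin 4 | j ≠ o} = (Finset.univ.erase o : Finset (Fin 4)) := by
    ext j
    simp
  rw [hset] at ho
  obtain ⟨m, hm0, hm⟩ := exists_lift_eq_sum_of_mem_hconvexHull (Finset.univ.erase o) x ho
  refine ahc_of_det_ne_zero x hv fun hdet => ?_
  obtain ⟨c, hc0, hc⟩ := Matrix.exists_vecMul_eq_zero_iff.2 hdet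
  refine hc0 (D.eq_zero_of_mem_hull (o := o) hm0 (fun z => ?_) c fun z => ?_)
  · simp only [hF, hm, map_sum, map_smul, smul_eq_mul]
  · have := congrArg (· ⬝ᵥ ![z.2 ^ 3, z.1 * z.2 ^ 2, z.1 ^ 2 * z.2, z.1 ^ 3]) hc
    simp only [← Matrix.dotProduct_mulVec, zero_dotProduct] at this
    simpa only [dotProduct, coeffMatrix_mulVec_moment] using this

end AtiyahHyperbolic

theorem theorem1 (x : AtiyahHyperbolic.Configuration 4) :
    (¬ x.Coplanar → x.AHC) ∧
    (x.Coplanar → (∃ i, x i ∈ AtiyahHyperbolic.hconvexHull (x '' {j | j ≠ i})) → x.AHC) :=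
  ⟨AtiyahHyperbolic.ahc_of_not_coplanar x,
    fun _ ⟨_, hi⟩ => AtiyahHyperbolic.ahc_of_mem_hconvexHull x hi⟩
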